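/- Let $n,m\in\mathbb{N}^*$, $T>0$, $x^0\in\mathbb{R}^n$, let $\mathrm{U}$ be an arbitrary nonempty subset of $\mathbb{R}^m$, and let $f:\mathbb{R}^n\times\mathbb{R}^m\times[0,T]\to\mathbb{R}^n$ be continuous and of class $\mathrm{C}^1$ with respect to its first two variables (its differential in $(x,u)$ exists and is continuous on $\mathbb{R}^n\times\mathbb{R}^m\times[0,T]$). A control $u\in \mathrm{L}^\infty([0,T],\mathbb{R}^m)$ is admissible if there is an absolutely continuous $x_u:[0,T]\to\mathbb{R}^n$ (then unique) with $x_u(0)=x^0$ and $\dot x_u(t)=f(x_u(t),u(t),t)$ for a.e. $t\in[0,T]$; $\mathcal{U}$ is the set of admissible controls and $\mathrm{E}:\mathcal{U}\to\mathbb{R}^n$, $\mathrm{E}(u)=x_u(T)$, is the end-point mapping. Let $\mathrm{L}^\infty([0,T],\mathrm{U})$ be the set of controls with values in $\mathrm{U}$ almost everywhere. The $\mathrm{L}^\infty_{\mathrm{U}}$-accessible set is $\mathrm{E}(\mathcal{U}\cap \mathrm{L}^\infty([0,T],\mathrm{U}))$, and its points are said to be $\mathrm{L}^\infty_{\mathrm{U}}$-reachable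 in time $T$ from $x^0$. For $u\in\mathcal{U}\cap \mathrm{L}^\infty([0,T],\mathrm{U})$, a Lebesgue point $\tau\in[0,T)$ of $t\mapsto f(x_u(t),u(t),t)$ and $\omega\in\mathrm{U}$, let $w^u_{(\tau,\omega)}$ be the absolutely continuous solution on $[\tau,T]$ of $\dot w(t)=\nabla_x f(x_u(t),u(t),t)\,w(t)$ for a.e. $t$, with $w(\tau)=f(x_u(\tau),\omega,\tau)-f(x_u(\tau),u(\tau),\tau)$. The control $u$ is weakly $\mathrm{U}$-regular if the smallest convex cone containing all vectors $w^u_{(\tau,\omega)}(T)$ is $\mathbb{R}^n$. If a control $u\in\mathcal{U}\cap \mathrm{L}^\infty([0,T],\mathrm{U})$ is weakly $\mathrm{U}$-regular, then there exist an open neighborhood $\mathcal{V}$ of $x_u(T)$ and a mapping $V:\mathcal{V}\to\mathcal{U}\cap \mathrm{L}^\infty([0,T],\mathrm{U})$, continuous when its codomain is endowed with the $\mathrm{L}^1$-metric, such that $V(x_u(T))=u$ and $\mathrm{E}(V(z))=z$ for all $z\in\mathcal{V}$. In particular, any point of $\mathcal{V}$ is $\mathrm{L}^\infty_{\mathrm{U}}$-reachable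 in time $T$ from $x^0$, and thus $x_u(T)$ belongs to the interior of the $\mathrm{L}^\infty_{\mathrm{U}}$-accessible set. -/

import Mathlib

open MeasureTheory Filter Topology Set
open scoped ENNReal

noncomputable section

/-- Controlled dynamics `f : ℝⁿ × ℝᵐ × [0,T] → ℝⁿ`, written in curried form. The values of
`f x u t` for `t` outside `[0,T]` are irrelevant everywhere below. -/
abbrev Dynamics (n m : ℕ) : Type :=
  EuclideanSpace ℝ (Fin n) → EuclideanSpace ℝ (Fin m) → ℝ → EuclideanSpace ℝ (Fin n)

/-- `f` is continuous on `ℝⁿ × ℝᵐ × [0,T]` and of class `C¹` with respect to its first two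
variables: its differential in `(x,u)` exists and is continuous on `ℝⁿ × ℝᵐ × [0,T]`. -/
structure IsC1Dynamics {n m : ℕ} (T : ℝ) (f : Dynamics n m) : Prop where
  continuousOn : ContinuousOn
    (fun q : (EuclideanSpace ℝ (Fin n) × EuclideanSpace ℝ (Fin m)) × ℝ => f q.1.1 q.1.2 q.2)
    (univ ×ˢ Icc 0 T)
  differentiable : ∀ t ∈ Icc (0 : ℝ) T, Differentiable ℝ
    (fun p : EuclideanSpace ℝ (Fin n) × EuclideanSpace ℝ (Fin m) => f p.1 p.2 t)
  continuousOn_fderiv : ContinuousOn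
    (fun q : (EuclideanSpace ℝ (Fin n) × EuclideanSpace ℝ (Fin m)) × ℝ =>
      fderiv ℝ
        (fun p : EuclideanSpace ℝ (Fin n) × EuclideanSpace ℝ (Fin m) => f p.1 p.2 q.2) q.1)
    (univ ×ˢ Icc 0 T)

/-- Lebesgue measure on the time interval `[0,T]`. -/
abbrev timeMeasure (T : ℝ) : Measure ℝ := volume.restrict (Icc 0 T)

/-- Controls: the space `L^∞([0,T], ℝᵐ)` (classes modulo almost everywhere equality). -/
abbrev Control (m : ℕ) (T : ℝ) : Type := Lp (EuclideanSpace ℝ (Fin m)) ∞ (timeMeasure T)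

/-- `L^∞([0,T], U)`: the controls with values in `U` almost everywhere. -/
def controlsIn {m : ℕ} (T : ℝ) (U : Set (EuclideanSpace ℝ (Fin m))) : Set (Control m T) :=
  {u | ∀ᵐ t ∂(timeMeasure T), u t ∈ U}

/-- The inclusion of `L^∞([0,T], ℝᵐ)` into `L¹([0,T], ℝᵐ)`; the `L¹`-metric on controls is the
metric it induces. -/
def Control.toL1 {m : ℕ} {T : ℝ} (u : Control m T) :
    Lp (EuclideanSpace ℝ (Fin m)) 1 (timeMeasure T) :=
  MemLp.toLp (u : ℝ → EuclideanSpace ℝ (Fin m)) ((Lp.memLp u).mono_exponent le_top)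

/-- `(x,u)` solves the control system `x'(t) = f(x(t),u(t),t)` for a.e. `t ∈ [0,T]`, with `x`
absolutely continuous on `[0,T]`. -/
def IsSolution {n m : ℕ} {T : ℝ} (f : Dynamics n m) (x : ℝ → EuclideanSpace ℝ (Fin n))
    (u : Control m T) : Prop :=
  AbsolutelyContinuousOnInterval x 0 T ∧
    ∀ᵐ t ∂(timeMeasure T), HasDerivAt x (f (x t) (u t) t) t

/-- `x₁` is `L^∞_U`-reachable in time `T` from `x₀`. -/
def IsReachable {n m : ℕ} (T : ℝ) (f : Dynamics n m) (x₀ : EuclideanSpace ℝ (Fin n))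
    (U : Set (EuclideanSpace ℝ (Fin m))) (x₁ : EuclideanSpace ℝ (Fin n)) : Prop :=
  ∃ (x : ℝ → EuclideanSpace ℝ (Fin n)) (u : Control m T),
    IsSolution f x u ∧ u ∈ controlsIn T U ∧ x 0 = x₀ ∧ x T = x₁

/-- The set `𝒰` of admissible controls. -/
def admissibleControls {n m : ℕ} (T : ℝ) (f : Dynamics n m) (x₀ : EuclideanSpace ℝ (Fin n)) :
    Set (Control m T) :=
  {u | ∃ x : ℝ → EuclideanSpace ℝ (Fin n), x 0 = x₀ ∧ IsSolution f x u}

/-- The trajectory `x_u` of an admissible control `u`. Its restriction to `[0,T]` is the unique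
solution starting at `x₀` as soon as `IsC1Dynamics T f` holds. -/
def trajectory {n m : ℕ} {T : ℝ} {f : Dynamics n m} {x₀ : EuclideanSpace ℝ (Fin n)}
    (u : admissibleControls T f x₀) : ℝ → EuclideanSpace ℝ (Fin n) :=
  Classical.choose u.2

/-- The end-point mapping `E : 𝒰 → ℝⁿ`, `E(u) = x_u(T)`. -/
def endpoint {n m : ℕ} {T : ℝ} {f : Dynamics n m} {x₀ : EuclideanSpace ℝ (Fin n)}
    (u : admissibleControls T f x₀) : EuclideanSpace ℝ (Fin n) :=
  trajectory u T

/-- The `L^∞_U`-accessible set `E(𝒰 ∩ L^∞([0,T],U))`. -/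
def accessibleSet {n m : ℕ} (T : ℝ) (f : Dynamics n m) (x₀ : EuclideanSpace ℝ (Fin n))
    (U : Set (EuclideanSpace ℝ (Fin m))) : Set (EuclideanSpace ℝ (Fin n)) :=
  endpoint '' {u : admissibleControls T f x₀ | (u : Control m T) ∈ controlsIn T U}

/-- `τ ∈ [0,T)` is a Lebesgue point of the function `g` given on `[0,T]`. -/
def IsLebesguePoint {n : ℕ} (T : ℝ) (g : ℝ → EuclideanSpace ℝ (Fin n)) (τ : ℝ) : Prop :=
  τ ∈ Ico 0 T ∧
    Tendsto (fun h : ℝ => ⨍ s in Icc (τ - h) (τ + h) ∩ Icc 0 T, ‖g s - g τ‖) (𝓝[>] 0) (𝓝 0)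

/-- `y` is a strong `U`-variation vector `w(T)` associated with `u`, where `w` solves the
linearized equation on `[τ,T]` and starts at `w(τ) = f(x_u(τ),ω,τ) - f(x_u(τ),u(τ),τ)`, with
`τ` a Lebesgue point of `f(x_u,u,·)` and `ω ∈ U`. Since `u(τ)` is a value at a single time, it
is taken in a representative `v` of the class `u` for which `τ` is a Lebesgue point; the vector
`f(x_u(τ),v(τ),τ)` is then determined by the class `u` and by `τ`. -/
def IsStrongVariationVector {n m : ℕ} {T : ℝ} {f : Dynamics n m}
    {x₀ : EuclideanSpace ℝ (Fin n)} (U : Set (EuclideanSpace ℝ (Fin m)))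
    (u : admissibleControls T f x₀) (y : EuclideanSpace ℝ (Fin n)) : Prop :=
  ∃ v : ℝ → EuclideanSpace ℝ (Fin m),
    v =ᵐ[timeMeasure T] ((u : Control m T) : ℝ → EuclideanSpace ℝ (Fin m)) ∧
    ∃ τ : ℝ, IsLebesguePoint T (fun t => f (trajectory u t) (v t) t) τ ∧
    ∃ ω ∈ U, ∃ w : ℝ → EuclideanSpace ℝ (Fin n),
      AbsolutelyContinuousOnInterval w τ T ∧
      (∀ᵐ t ∂(volume.restrict (Icc τ T)),
        HasDerivAt w (fderiv ℝ (fun z => f z (v t) t) (trajectory u t) (w t)) t) ∧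
      w τ = f (trajectory u τ) ω τ - f (trajectory u τ) (v τ) τ ∧
      w T = y

/-- The `U`-Pontryagin cone of `u`: the smallest convex cone (with apex `0`) containing all strong
`U`-variation vectors associated with `u`. -/
def pontryaginCone {n m : ℕ} {T : ℝ} {f : Dynamics n m} {x₀ : EuclideanSpace ℝ (Fin n)}
    (U : Set (EuclideanSpace ℝ (Fin m))) (u : admissibleControls T f x₀) :
    PointedCone ℝ (EuclideanSpace ℝ (Fin n)) :=
  PointedCone.hull ℝ {y | IsStrongVariationVector U u y}

/-- `u` is weakly `U`-regular: its `U`-Pontryagin cone is the whole space. -/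
def IsWeaklyRegular {n m : ℕ} {T : ℝ} {f : Dynamics n m} {x₀ : EuclideanSpace ℝ (Fin n)}
    (U : Set (EuclideanSpace ℝ (Fin m))) (u : admissibleControls T f x₀) : Prop :=
  (pontryaginCone U u : Set (EuclideanSpace ℝ (Fin n))) = univ

end

/-! The end-point mapping is inverted along a finite family of needle variations. Weak regularity
gives finitely many variation vectors `w i T` and nonnegative Lipschitz coefficients `σ z i`,
vanishing at `z = 0`, with `∑ i, σ z i • w i T = z` (`exists_lipschitz_nonneg_coefficients`:
decompose the vectors `± e_j` in the cone and use positive and negative parts of coordinates).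

For parameters `α i ≥ 0` the control is replaced by `ω i` on a set `A i (α i)` of measure `α i`.
These sets need not shrink to `τ i`. They lie in the set of times `s > τ i` where the jump of the
dynamics caused by `ω i` is close to the linearized solution `W i s` at that same time. A needle of
small measure placed at such a time moves the end-point by nearly that measure times `W i T`. The
Lebesgue point property makes this set of times non-null (`IsLebesguePoint.volume_pos`), so several
needles can be made disjoint even when the `τ i` coincide. For each `i` the sets are nested in the
parameter, so symmetric differences have measure `|α i - β i|`.

A Grönwall estimate on the first-order remainder (`norm_sub_sub_sum_le_of_needleControl`) shows that
differences of end-points equal `∑ i, (α i - β i) • w i T` up to `ε * ∑ i, |α i - β i|`, uniformly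
in a small box (`exists_needle_family`). Only one fixed `ε` is needed: after composing with `σ`, the
map `z ↦ x (σ z) T` differs from a translation by a `1/2`-Lipschitz map on a ball, so it is
invertible there (`exists_local_section`). Its inverse followed by `z ↦ needleControl` is `V`; it is
continuous in `L¹` because the needles depend on `z` in a Lipschitz way, and it returns `u` at the
centre because `σ 0 = 0` and `A i 0` is null. -/

/-! ### Calculus of vector-valued absolutely continuous functions. -/

section AbsolutelyContinuous

variable {E : Type*} [NormedAddCommGroup E]

theorem AbsolutelyContinuousOnInterval.of_dist_le {X Y : Type*} [PseudoMetricSpace X]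
    [PseudoMetricSpace Y] {f : ℝ → X} {g : ℝ → Y} {a b : ℝ}
    (hg : AbsolutelyContinuousOnInterval g a b)
    (h : ∀ s ∈ uIcc a b, ∀ t ∈ uIcc a b, dist (f s) (f t) ≤ dist (g s) (g t)) :
    AbsolutelyContinuousOnInterval f a b := by
  rw [absolutelyContinuousOnInterval_iff] at hg ⊢
  intro ε hε
  obtain ⟨δ, hδ, H⟩ := hg ε hε
  refine ⟨δ, hδ, fun I hI hI' => lt_of_le_of_lt (Finset.sum_le_sum fun i hi => ?_) (H I hI hI')⟩
  exact h _ (hI.1 i hi).1 _ (hI.1 i hi).2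

theorem AbsolutelyContinuousOnInterval.congr {X : Type*} [PseudoMetricSpace X]
    {f g : ℝ → X} {a b : ℝ} (hg : AbsolutelyContinuousOnInterval g a b)
    (h : EqOn f g (uIcc a b)) : AbsolutelyContinuousOnInterval f a b :=
  hg.of_dist_le fun s hs t ht => by rw [h hs, h ht]

theorem AbsolutelyContinuousOnInterval.fun_sum {ι : Type*} (S : Finset ι) {f : ι → ℝ → E} {a b : ℝ}
    (hf : ∀ i ∈ S, AbsolutelyContinuousOnInterval (f i) a b) :
    AbsolutelyContinuousOnInterval (fun t => ∑ i ∈ S, f i t) a b := by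
  classical
  induction S using Finset.induction_on with
  | empty =>
    simp only [Finset.sum_empty]
    exact (LipschitzWith.const (0 : E)).lipschitzOnWith.absolutelyContinuousOnInterval
  | insert i S hi ih =>
    simp only [Finset.sum_insert hi]
    exact (hf i (by simp)).add (ih fun j hj => hf j (by simp [hj]))

variable [NormedSpace ℝ E]

theorem absolutelyContinuousOnInterval_integral {k : ℝ → E} {a b : ℝ}
    (hk : IntervalIntegrable k volume a b) :
    AbsolutelyContinuousOnInterval (fun t => ∫ s in a..t, k s) a b := by
  refine (hk.norm.absolutelyContinuousOnInterval_intervalIntegral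
    (c := a) left_mem_uIcc).of_dist_le fun s hs t ht => ?_
  have H : ∀ r ∈ uIcc a b, IntervalIntegrable k volume a r := fun r hr =>
    hk.mono_set (uIcc_subset_uIcc left_mem_uIcc hr)
  rw [dist_eq_norm, dist_eq_norm, intervalIntegral.integral_interval_sub_left (H s hs) (H t ht),
    intervalIntegral.integral_interval_sub_left (H s hs).norm (H t ht).norm, Real.norm_eq_abs]
  exact intervalIntegral.norm_integral_le_abs_integral_norm

variable [CompleteSpace E]

/-- The fundamental theorem of calculus for vector-valued absolutely continuous functions. -/
theorem AbsolutelyContinuousOnInterval.eq_add_integral {x k : ℝ → E} {a b : ℝ} (hab : a ≤ b)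
    (hx : AbsolutelyContinuousOnInterval x a b)
    (hd : ∀ᵐ t ∂(volume.restrict (Icc a b)), HasDerivAt x (k t) t)
    (hk : IntervalIntegrable k volume a b) {t : ℝ} (ht : t ∈ Icc a b) :
    x t = x a + ∫ s in a..t, k s := by
  have hd' := (ae_restrict_iff' measurableSet_Icc).1 hd
  have hac := hx.sub (absolutelyContinuousOnInterval_integral hk)
  obtain ⟨C, hC⟩ := hac.const_of_ae_hasDerivAt_zero (by
    filter_upwards [hd', hk.ae_hasDerivAt_integral] with s h1 h2 hs
    rw [uIcc_of_le hab] at hs h2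
    simpa using (h1 hs).sub (h2 hs a (left_mem_Icc.2 hab)))
  rw [uIcc_of_le hab] at hC
  have h1 := hC a (left_mem_Icc.2 hab)
  have h2 := hC t ht
  simp only [Pi.sub_apply, intervalIntegral.integral_same, sub_zero] at h1 h2
  rw [h1, ← h2]; abel

/-- Measurability of `k` comes for free, since `k` agrees almost everywhere with `deriv x`; only a
dominating function has to be supplied. -/
theorem AbsolutelyContinuousOnInterval.intervalIntegrable_of_norm_le [SecondCountableTopology E]
    {x k : ℝ → E} {ρ : ℝ → ℝ} {a b : ℝ} (hab : a ≤ b)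
    (hd : ∀ᵐ t ∂(volume.restrict (Icc a b)), HasDerivAt x (k t) t)
    (hρ : IntervalIntegrable ρ volume a b)
    (hkρ : ∀ᵐ t ∂(volume.restrict (Icc a b)), ‖k t‖ ≤ ρ t) :
    IntervalIntegrable k volume a b := by
  borelize E
  rw [intervalIntegrable_iff_integrableOn_Icc_of_le hab] at hρ ⊢
  refine Integrable.mono' hρ ?_ hkρ
  refine (stronglyMeasurable_deriv x).aestronglyMeasurable.congr ?_
  filter_upwards [hd] with t ht using ht.deriv

theorem AbsolutelyContinuousOnInterval.lipschitzOnWith [SecondCountableTopology E] {x k : ℝ → E}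
    {a b : ℝ} {C : NNReal} (hab : a ≤ b) (hx : AbsolutelyContinuousOnInterval x a b)
    (hd : ∀ᵐ t ∂(volume.restrict (Icc a b)), HasDerivAt x (k t) t)
    (hC : ∀ᵐ t ∂(volume.restrict (Icc a b)), ‖k t‖ ≤ C) : LipschitzOnWith C x (Icc a b) := by
  have hk := AbsolutelyContinuousOnInterval.intervalIntegrable_of_norm_le hab hd
    (intervalIntegrable_const (c := (C : ℝ))) hC
  refine LipschitzOnWith.of_dist_le_mul fun s hs t ht => ?_
  have H : ∀ r ∈ Icc a b, IntervalIntegrable k volume a r := fun r hr =>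
    hk.mono_set (uIcc_subset_uIcc left_mem_uIcc (by rwa [uIcc_of_le hab]))
  rw [hx.eq_add_integral hab hd hk hs, hx.eq_add_integral hab hd hk ht, dist_add_left,
    dist_eq_norm, intervalIntegral.integral_interval_sub_left (H s hs) (H t ht), Real.dist_eq]
  refine intervalIntegral.norm_integral_le_of_norm_le_const_ae ?_
  filter_upwards [(ae_restrict_iff' measurableSet_Icc).1 hC] with r hr hrs
  refine hr ⟨?_, ?_⟩
  · exact (le_min ht.1 hs.1).trans hrs.1.le
  · exact hrs.2.trans (max_le ht.2 hs.2)

end AbsolutelyContinuous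

/-! ### Grönwall inequalities in integral and almost-everywhere form. -/

section Gronwall

/-- The differential Grönwall inequality is applied to the right-hand side of `h`, which is
differentiable although `φ` is only continuous. -/
theorem le_mul_exp_of_le_add_integral {φ : ℝ → ℝ} {b Λ T : ℝ} (hΛ : 0 ≤ Λ) (hφ : Continuous φ)
    (h : ∀ t ∈ Icc 0 T, φ t ≤ b + Λ * ∫ s in 0..t, φ s) {t : ℝ} (ht : t ∈ Icc 0 T) :
    φ t ≤ b * Real.exp (Λ * t) := by
  have hder : ∀ t, HasDerivAt (fun t => b + Λ * ∫ s in 0..t, φ s) (Λ * φ t) t := fun t =>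
    ((intervalIntegral.integral_hasDerivAt_right (hφ.intervalIntegrable _ _)
      (hφ.stronglyMeasurableAtFilter _ _) hφ.continuousAt).const_mul Λ).const_add b
  have := le_gronwallBound_of_liminf_deriv_right_le (f := fun t => b + Λ * ∫ s in 0..t, φ s)
    (f' := fun t => Λ * φ t) (δ := b) (K := Λ) (ε := 0) (a := 0) (b := T)
    (fun t _ => (hder t).continuousAt.continuousWithinAt)
    (fun t _ r hr => (hder t).hasDerivWithinAt.liminf_right_slope_le hr)
    (by simp) (fun t ht => by
      rw [add_zero]
      exact mul_le_mul_of_nonneg_left (h t (Ico_subset_Icc_self ht)) hΛ) t ht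
  rw [gronwallBound_ε0, sub_zero] at this
  exact (h t ht).trans this

variable {E : Type*} [NormedAddCommGroup E] [NormedSpace ℝ E] [CompleteSpace E]
  [SecondCountableTopology E]

/-- Grönwall's inequality for absolutely continuous functions. -/
theorem AbsolutelyContinuousOnInterval.norm_le_mul_exp {e k : ℝ → E} {ρ : ℝ → ℝ} {T Λ : ℝ}
    (hT : 0 ≤ T) (hΛ : 0 ≤ Λ) (he : AbsolutelyContinuousOnInterval e 0 T) (he0 : e 0 = 0)
    (hd : ∀ᵐ t ∂(volume.restrict (Icc 0 T)), HasDerivAt e (k t) t)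
    (hρ : IntervalIntegrable ρ volume 0 T) (hρ0 : ∀ t, 0 ≤ ρ t)
    (hk : ∀ᵐ t ∂(volume.restrict (Icc 0 T)), ‖k t‖ ≤ Λ * ‖e t‖ + ρ t) {t : ℝ}
    (ht : t ∈ Icc 0 T) : ‖e t‖ ≤ (∫ s in 0..T, ρ s) * Real.exp (Λ * T) := by
  have hec : ContinuousOn e (Icc 0 T) := by simpa [uIcc_of_le hT] using he.continuousOn
  have hbd : IntervalIntegrable (fun t => Λ * ‖e t‖ + ρ t) volume 0 T :=
    (IntervalIntegrable.const_mul (ContinuousOn.intervalIntegrable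
      (by simpa [uIcc_of_le hT] using hec.norm)) Λ).add hρ
  have hki := AbsolutelyContinuousOnInterval.intervalIntegrable_of_norm_le hT hd hbd hk
  -- Clamping time gives a function continuous on the whole line that agrees with `‖e‖` on `[0,T]`.
  let φ : ℝ → ℝ := fun t => ‖e (projIcc 0 T hT t)‖
  have hφ : Continuous φ := (continuousOn_iff_continuous_domRestrict.1 hec).norm.comp continuous_projIcc
  have hφe : ∀ t ∈ Icc 0 T, φ t = ‖e t‖ := fun t ht => by simp [φ, projIcc_of_mem hT ht]
  have key : ∀ t ∈ Icc 0 T, φ t ≤ (∫ s in 0..T, ρ s) + Λ * ∫ s in 0..t, φ s := by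
    intro t ht
    have hsub : uIcc 0 t ⊆ uIcc 0 T := uIcc_subset_uIcc left_mem_uIcc (by rwa [uIcc_of_le hT])
    rw [hφe t ht, he.eq_add_integral hT hd hki ht, he0, zero_add]
    have h1 : ‖∫ s in 0..t, k s‖ ≤ ∫ s in 0..t, (Λ * φ s + ρ s) := by
      refine intervalIntegral.norm_integral_le_of_norm_le ht.1 ?_ ?_
      · filter_upwards [(ae_restrict_iff' measurableSet_Icc).1 hk] with s hs hst
        have : s ∈ Icc 0 T := ⟨hst.1.le, hst.2.trans ht.2⟩
        rw [hφe s this]; exact hs this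
      · exact ((hφ.intervalIntegrable _ _).const_mul Λ).add (hρ.mono_set hsub)
    rw [intervalIntegral.integral_add ((hφ.intervalIntegrable _ _).const_mul Λ) (hρ.mono_set hsub),
      intervalIntegral.integral_const_mul] at h1
    have h2 : ∫ s in 0..t, ρ s ≤ ∫ s in 0..T, ρ s :=
      intervalIntegral.integral_mono_interval le_rfl ht.1 ht.2 (ae_of_all _ hρ0) hρ
    linarith
  have := le_mul_exp_of_le_add_integral hΛ hφ key ht
  rw [hφe t ht] at this
  refine this.trans (mul_le_mul_of_nonneg_left (Real.exp_le_exp.2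
    (mul_le_mul_of_nonneg_left ht.2 hΛ)) (intervalIntegral.integral_nonneg hT fun s _ => hρ0 s))

end Gronwall

/-! ### Existence of solutions near an approximate solution. -/

section Picard

variable {E : Type*} [NormedAddCommGroup E] [NormedSpace ℝ E] [CompleteSpace E]

/-- A vector field which is measurable in time and Lipschitz in a tube of radius `1` about an
approximate solution `xb` has an exact solution in that tube. -/
theorem exists_eq_add_integral_of_approx_solution {h : E → ℝ → E} {xb : ℝ → E} {x₀ : E}
    {T Λ η : ℝ} (hT : 0 ≤ T) (hΛ : 0 < Λ) (hxb : Continuous xb)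
    (hint : ∀ x : ℝ → E, Continuous x → (∀ s ∈ Icc 0 T, ‖x s - xb s‖ ≤ 1) →
      IntervalIntegrable (fun s => h (x s) s) volume 0 T)
    (hLip : ∀ s ∈ Icc 0 T, ∀ a b, ‖a - xb s‖ ≤ 1 → ‖b - xb s‖ ≤ 1 →
      ‖h a s - h b s‖ ≤ Λ * ‖a - b‖)
    (hη : ∀ t ∈ Icc 0 T, ‖x₀ + (∫ s in 0..t, h (xb s) s) - xb t‖ ≤ η)
    (hsmall : 2 * η * Real.exp (2 * Λ * T) ≤ 1) :
    ∃ x : ℝ → E, Continuous x ∧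
      (∀ t ∈ Icc 0 T, ‖x t - xb t‖ ≤ 2 * η * Real.exp (2 * Λ * T)) ∧
      ∀ t ∈ Icc 0 T, x t = x₀ + ∫ s in 0..t, h (x s) s := by
  have hη0 : 0 ≤ η := (norm_nonneg _).trans (hη 0 (left_mem_Icc.2 hT))
  -- The radius `2 * η` is stable: the Picard map sends `0` to a point of norm at most `η` and
  -- contracts by `1/2`.
  let S := Metric.closedBall (0 : C(Icc (0 : ℝ) T, E)) (2 * η)
  have : CompleteSpace S := Metric.isClosed_closedBall.completeSpace_coe
  have : Nonempty S := ⟨⟨0, Metric.mem_closedBall_self (by positivity)⟩⟩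
  -- The deviation from `xb` is measured with the exponential weight of Bielecki, so that the
  -- contraction factor is `1/2` whatever the length of the interval.
  let X : C(Icc (0 : ℝ) T, E) → ℝ → E :=
    fun y s => xb s + Real.exp (2 * Λ * s) • y (projIcc 0 T hT s)
  have hXc : ∀ y, Continuous (X y) := fun y => by
    have := y.continuous.comp (continuous_projIcc (h := hT))
    exact hxb.add ((by fun_prop : Continuous fun s : ℝ => Real.exp (2 * Λ * s)).smul this)
  have hXd : ∀ y y' s, ‖X y s - X y' s‖ ≤ Real.exp (2 * Λ * s) * ‖y - y'‖ := fun y y' s => by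
    have : X y s - X y' s = Real.exp (2 * Λ * s) • (y - y') (projIcc 0 T hT s) := by
      simp [X, smul_sub]
    rw [this, norm_smul, Real.norm_of_nonneg (Real.exp_nonneg _)]
    exact mul_le_mul_of_nonneg_left (ContinuousMap.norm_coe_le_norm _ _) (Real.exp_nonneg _)
  have hX0 : X 0 = xb := by ext s; simp [X]
  have hexp : ∀ s ∈ Icc 0 T, Real.exp (2 * Λ * s) ≤ Real.exp (2 * Λ * T) := fun s hs =>
    Real.exp_le_exp.2 (mul_le_mul_of_nonneg_left hs.2 (by positivity))
  have hXS : ∀ y ∈ S, ∀ s ∈ Icc 0 T, ‖X y s - xb s‖ ≤ 2 * η * Real.exp (2 * Λ * T) := by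
    intro y hy s hs
    have h1 := hXd y 0 s
    rw [hX0, sub_zero] at h1
    refine h1.trans ?_
    rw [mul_comm (2 * η)]
    exact mul_le_mul (hexp s hs) (mem_closedBall_zero_iff.1 hy) (norm_nonneg _) (Real.exp_nonneg _)
  have hX1 : ∀ y ∈ S, ∀ s ∈ Icc 0 T, ‖X y s - xb s‖ ≤ 1 := fun y hy s hs =>
    (hXS y hy s hs).trans hsmall
  have hI : ∀ y ∈ S, ∀ t ∈ Icc 0 T, IntervalIntegrable (fun s => h (X y s) s) volume 0 t :=
    fun y hy t ht => (hint _ (hXc y) (hX1 y hy)).mono_set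
      (uIcc_subset_uIcc left_mem_uIcc (by rwa [uIcc_of_le hT]))
  -- The Picard operator, written in the weighted coordinate `y`.
  let q : C(Icc (0 : ℝ) T, E) → ℝ → E := fun y t =>
    Real.exp (-(2 * Λ * t)) • (x₀ + (∫ s in 0..t, h (X y s) s) - xb t)
  have hqc : ∀ y ∈ S, Continuous fun t : Icc (0 : ℝ) T => q y t := by
    intro y hy
    have h1 : ContinuousOn (fun t => ∫ s in 0..t, h (X y s) s) (Icc 0 T) := by
      have := (absolutelyContinuousOnInterval_integral
        (hI y hy T (right_mem_Icc.2 hT))).continuousOn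
      rwa [uIcc_of_le hT] at this
    have h2 := continuousOn_iff_continuous_domRestrict.1 h1
    have h3 : Continuous fun t : Icc (0 : ℝ) T => Real.exp (-(2 * Λ * (t : ℝ))) := by fun_prop
    exact h3.smul ((continuous_const.add h2).sub (hxb.comp continuous_subtype_val))
  have hqd : ∀ y ∈ S, ∀ y' ∈ S, ∀ t ∈ Icc 0 T, ‖q y t - q y' t‖ ≤ 1 / 2 * ‖y - y'‖ := by
    intro y hy y' hy' t ht
    have h1 : q y t - q y' t
        = Real.exp (-(2 * Λ * t)) • ∫ s in 0..t, (h (X y s) s - h (X y' s) s) := by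
      rw [intervalIntegral.integral_sub (hI y hy t ht) (hI y' hy' t ht), ← smul_sub]
      congr 1; abel
    have h2 : ∫ s in 0..t, Λ * (Real.exp (2 * Λ * s) * ‖y - y'‖)
        = 1 / 2 * ‖y - y'‖ * (Real.exp (2 * Λ * t) - 1) := by
      have hd : ∀ s ∈ uIcc 0 t, HasDerivAt (fun s => 1 / 2 * ‖y - y'‖ * Real.exp (2 * Λ * s))
          (Λ * (Real.exp (2 * Λ * s) * ‖y - y'‖)) s := fun s _ => by
        have := (((hasDerivAt_id s).const_mul (2 * Λ)).exp).const_mul (1 / 2 * ‖y - y'‖)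
        exact this.congr_deriv (by simp only [id_eq, mul_one]; ring)
      rw [intervalIntegral.integral_eq_sub_of_hasDerivAt hd
        (Continuous.intervalIntegrable (by fun_prop) _ _)]
      simp; ring
    have h3 : ‖∫ s in 0..t, (h (X y s) s - h (X y' s) s)‖
        ≤ 1 / 2 * ‖y - y'‖ * (Real.exp (2 * Λ * t) - 1) := by
      rw [← h2]
      refine intervalIntegral.norm_integral_le_of_norm_le ht.1 (ae_of_all _ fun s hs => ?_)
        (Continuous.intervalIntegrable (by fun_prop) _ _)
      have hs' : s ∈ Icc 0 T := ⟨hs.1.le, hs.2.trans ht.2⟩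
      exact (hLip s hs' _ _ (hX1 y hy s hs') (hX1 y' hy' s hs')).trans
        (mul_le_mul_of_nonneg_left (hXd y y' s) hΛ.le)
    rw [h1, norm_smul, Real.norm_of_nonneg (Real.exp_nonneg _)]
    calc _ ≤ Real.exp (-(2 * Λ * t)) * (1 / 2 * ‖y - y'‖ * (Real.exp (2 * Λ * t) - 1)) :=
          mul_le_mul_of_nonneg_left h3 (Real.exp_nonneg _)
      _ = 1 / 2 * ‖y - y'‖ * (1 - Real.exp (-(2 * Λ * t))) := by
          have : Real.exp (-(2 * Λ * t)) * Real.exp (2 * Λ * t) = 1 := by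
            rw [← Real.exp_add]; simp
          linear_combination 1 / 2 * ‖y - y'‖ * this
      _ ≤ 1 / 2 * ‖y - y'‖ * 1 :=
          mul_le_mul_of_nonneg_left (by linarith [Real.exp_nonneg (-(2 * Λ * t))]) (by positivity)
      _ = _ := mul_one _
  have h0S : (0 : C(Icc (0 : ℝ) T, E)) ∈ S := Metric.mem_closedBall_self (by positivity)
  have hq0 : ∀ t ∈ Icc 0 T, ‖q 0 t‖ ≤ η := by
    intro t ht
    simp only [q, norm_smul, hX0, Real.norm_of_nonneg (Real.exp_nonneg _)]
    refine (mul_le_of_le_one_left (norm_nonneg _) ?_).trans (hη t ht)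
    rw [Real.exp_le_one_iff]
    have := ht.1
    simp only [Left.neg_nonpos_iff]; positivity
  let Q : S → S := fun y => ⟨⟨fun t => q y t, hqc y y.2⟩, by
    rw [mem_closedBall_zero_iff, ContinuousMap.norm_le _ (by positivity)]
    intro t
    have h1 := hqd y y.2 0 h0S t t.2
    have h2 : ‖(y : C(Icc (0 : ℝ) T, E)) - 0‖ ≤ 2 * η := by
      rw [sub_zero]; exact mem_closedBall_zero_iff.1 y.2
    calc ‖q y t‖ = ‖(q y t - q 0 t) + q 0 t‖ := by rw [sub_add_cancel]
      _ ≤ ‖q y t - q 0 t‖ + ‖q 0 t‖ := norm_add_le _ _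
      _ ≤ 2 * η := by linarith [hq0 t t.2]⟩
  have hQ : ContractingWith (1 / 2) Q := by
    refine ⟨by norm_num [← NNReal.coe_lt_coe], LipschitzWith.of_dist_le_mul fun y y' => ?_⟩
    rw [Subtype.dist_eq, Subtype.dist_eq, ContinuousMap.dist_le (by positivity)]
    intro t
    rw [dist_eq_norm, dist_eq_norm]
    exact hqd y y.2 y' y'.2 t t.2
  let y := hQ.fixedPoint Q
  have hy : Q y = y := hQ.fixedPoint_isFixedPt
  refine ⟨X y, hXc y, hXS y y.2, fun t ht => ?_⟩
  have h1 : q y t = (y : C(Icc (0 : ℝ) T, E)) ⟨t, ht⟩ := by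
    conv_rhs => rw [← hy]
    rfl
  simp only [X, projIcc_of_mem hT ht, ← h1, q, smul_smul, ← Real.exp_add]
  simp

end Picard

/-! ### Nested and disjoint sets of prescribed or positive measure; Lebesgue points. -/

section Measure

/-- The measure of `B ∩ Ioc 0 a` is continuous in `a`, so the intermediate value theorem yields a
truncation of each measure. -/
theorem exists_monotone_family_of_volume {B : Set ℝ} {T : ℝ} (hT : 0 ≤ T) (hB : MeasurableSet B)
    (hBT : B ⊆ Ioc 0 T) :
    ∃ A : ℝ → Set ℝ, (∀ α, MeasurableSet (A α)) ∧ (∀ α, A α ⊆ B) ∧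
      (∀ α ∈ Icc 0 (volume.real B), volume.real (A α) = α) ∧
      ∀ α ∈ Icc 0 (volume.real B), ∀ β ∈ Icc 0 (volume.real B), α ≤ β → A α ⊆ A β := by
  let F : ℝ → ℝ := fun a => ∫ s in 0..a, B.indicator (fun _ => (1 : ℝ)) s
  have hint : Integrable (B.indicator (fun _ => (1 : ℝ))) volume :=
    (integrable_indicator_iff hB).2
      (integrableOn_const (measure_mono hBT |>.trans_lt measure_Ioc_lt_top).ne)
  have hF : Continuous F := intervalIntegral.continuous_primitive
    (fun a b => hint.intervalIntegrable) 0
  have hFv : ∀ a, 0 ≤ a → F a = volume.real (B ∩ Ioc 0 a) := fun a ha => by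
    simp only [F, intervalIntegral.integral_of_le ha]
    exact (integral_indicator_one hB).trans (measureReal_restrict_apply hB)
  have hF0 : F 0 = 0 := by simp [F]
  have hFT : F T = volume.real B := by rw [hFv T hT, inter_eq_left.2 hBT]
  have hivt : ∀ α ∈ Icc 0 (volume.real B), ∃ a ∈ Icc 0 T, F a = α := by
    intro α hα
    have := intermediate_value_Icc hT hF.continuousOn
    rw [hF0, hFT] at this
    exact this hα
  choose! a ha hFa using hivt
  refine ⟨fun α => B ∩ Ioc 0 (a α), fun α => hB.inter measurableSet_Ioc,
    fun α => inter_subset_left, fun α hα => ?_, fun α hα β hβ hαβ => ?_⟩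
  · rw [← hFv _ (ha α hα).1, hFa α hα]
  -- The truncation levels are chosen independently of each other, so their order is recovered from
  -- the strict order of the measures.
  · rcases hαβ.eq_or_lt with rfl | hlt
    · exact le_rfl
    · refine inter_subset_inter_right _ (Ioc_subset_Ioc_right ?_)
      by_contra! hcon
      have : F (a β) ≤ F (a α) := by
        rw [hFv _ (ha α hα).1, hFv _ (ha β hβ).1]
        exact measureReal_mono (inter_subset_inter_right _ (Ioc_subset_Ioc_right hcon.le))
          ((measure_mono inter_subset_right).trans_lt measure_Ioc_lt_top).ne
      rw [hFa α hα, hFa β hβ] at this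
      linarith

/-- At each induction step the new index keeps only a piece of measure `c`, which is removed from
all other sets. Since `c` is smaller than the measure of every current set, all of them stay
non-null, including those not yet treated. -/
theorem exists_pairwiseDisjoint_subset_of_volume_pos {ι : Type*} [Fintype ι] {S : ι → Set ℝ}
    {T : ℝ} (hT : 0 ≤ T) (hS : ∀ i, MeasurableSet (S i)) (hST : ∀ i, S i ⊆ Ioc 0 T)
    (hpos : ∀ i, 0 < volume.real (S i)) :
    ∃ B : ι → Set ℝ, (∀ i, MeasurableSet (B i)) ∧ (∀ i, B i ⊆ S i) ∧
      (∀ i, 0 < volume.real (B i)) ∧ Pairwise (Function.onFun Disjoint B) := by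
  classical
  have key : ∀ s : Finset ι, ∃ B : ι → Set ℝ, (∀ i, MeasurableSet (B i)) ∧ (∀ i, B i ⊆ S i) ∧
      (∀ i, 0 < volume.real (B i)) ∧ (s : Set ι).PairwiseDisjoint B := by
    intro s
    induction s using Finset.induction_on with
    | empty => exact ⟨S, hS, fun i => le_rfl, hpos, by simp⟩
    | insert a s ha ih =>
      obtain ⟨B, hBm, hBS, hBpos, hBd⟩ := ih
      obtain ⟨c, hc0, hc⟩ : ∃ c, 0 < c ∧ ∀ i, c < volume.real (B i) := by
        obtain ⟨c, hc0, hc⟩ := Pi.exists_forall_pos_add_lt (x := fun _ => (0 : ℝ)) hBpos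
        exact ⟨c, hc0, fun i => by simpa using hc i⟩
      obtain ⟨A, hAm, hAB, hAv, -⟩ :=
        exists_monotone_family_of_volume hT (hBm a) ((hBS a).trans (hST a))
      have hC : volume.real (A c) = c := hAv c ⟨hc0.le, (hc a).le⟩
      refine ⟨fun i => if i = a then A c else B i \ A c, fun i => ?_, fun i => ?_, fun i => ?_, ?_⟩
      · dsimp only
        split_ifs
        exacts [hAm c, (hBm i).diff (hAm c)]
      · dsimp only
        split_ifs with h
        · subst h; exact (hAB c).trans (hBS i)
        · exact sdiff_subset.trans (hBS i)
      · dsimp only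
        split_ifs with h
        · rwa [hC]
        · have := le_measureReal_sdiff (μ := volume) (s₁ := B i) (s₂ := A c)
            (h := ((measure_mono ((hAB c).trans ((hBS a).trans (hST a)))).trans_lt
              measure_Ioc_lt_top).ne)
          have h2 := hc i
          rw [hC] at this
          linarith
      · intro i hi j hj hij
        simp only [Finset.coe_insert, mem_insert_iff, Finset.mem_coe] at hi hj
        simp only [Function.onFun]
        split_ifs with h1 h2 h2
        · exact absurd (h1.trans h2.symm) hij
        · exact disjoint_sdiff_right
        · exact disjoint_sdiff_left
        · exact (hBd (hi.resolve_left h1) (hj.resolve_left h2) hij).mono sdiff_subset sdiff_subset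
  obtain ⟨B, h1, h2, h3, h4⟩ := key Finset.univ
  exact ⟨B, h1, h2, h3, fun i j hij => h4 (by simp) (by simp) hij⟩

/-- Otherwise `‖g s - g τ‖ ≥ ε` almost everywhere just to the right of `τ`, and the averages over
small windows could not tend to `0`. The second function `g'` allows the representative of the
control to change while the reference value `g τ` is kept. -/
theorem IsLebesguePoint.volume_pos {n : ℕ} {T : ℝ} {g g' : ℝ → EuclideanSpace ℝ (Fin n)} {τ : ℝ}
    (hτ : IsLebesguePoint T g τ) (hg : IntegrableOn g (Icc 0 T))
    (hgg' : ∀ᵐ t ∂(timeMeasure T), g t = g' t)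
    {ε δ : ℝ} (hε : 0 < ε) (hδ : 0 < δ) :
    0 < volume {s | s ∈ Ioo τ (min (τ + δ) T) ∧ ‖g' s - g τ‖ < ε} := by
  obtain ⟨⟨hτ0, hτT⟩, hlim⟩ := hτ
  by_contra hcon
  have hzero := nonpos_iff_eq_zero.1 (not_lt.1 hcon)
  have hae : ∀ᵐ s, s ∈ Ioo τ (min (τ + δ) T) → ε ≤ ‖g s - g τ‖ := by
    filter_upwards [measure_eq_zero_iff_ae_notMem.1 hzero,
      (ae_restrict_iff' measurableSet_Icc).1 hgg'] with s hs hs' hsI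
    rw [hs' ⟨hτ0.trans hsI.1.le, hsI.2.le.trans (min_le_right _ _)⟩]
    by_contra! hlt
    exact hs ⟨hsI, hlt⟩
  -- The right half of the window has length `h` and the window has measure at most `2 * h`, so the
  -- average is at least `ε / 2`.
  have h1 : ∀ᶠ h in 𝓝[>] (0 : ℝ),
      ⨍ s in Icc (τ - h) (τ + h) ∩ Icc 0 T, ‖g s - g τ‖ < ε / 2 :=
    hlim.eventually (gt_mem_nhds (by positivity))
  have h2 : ∀ᶠ h in 𝓝[>] (0 : ℝ), h ∈ Ioo 0 (min δ (T - τ)) :=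
    Ioo_mem_nhdsGT (lt_min hδ (by linarith))
  obtain ⟨h, hlt, hh0, hhlt⟩ := (h1.and h2).exists
  have hhδ := hhlt.trans_le (min_le_left _ _)
  have hhT := hhlt.trans_le (min_le_right _ _)
  set J := Icc (τ - h) (τ + h) ∩ Icc 0 T with hJ
  have hsub : Ioo τ (τ + h) ⊆ J := fun s hs =>
    ⟨⟨by linarith [hs.1], hs.2.le⟩, ⟨by linarith [hs.1], by linarith [hs.2]⟩⟩
  have hJfin : volume J ≠ ∞ := ((measure_mono inter_subset_left).trans_lt measure_Icc_lt_top).ne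
  have hJ2 : volume.real J ≤ 2 * h := by
    refine (measureReal_mono (inter_subset_left : J ⊆ Icc (τ - h) (τ + h))
      measure_Icc_lt_top.ne).trans ?_
    rw [Real.volume_real_Icc_of_le (by linarith)]; linarith
  have hJ1 : h ≤ volume.real J := by
    refine le_trans ?_ (measureReal_mono hsub hJfin)
    rw [Real.volume_real_Ioo_of_le (by linarith)]; linarith
  have hi : IntegrableOn (fun s => ‖g s - g τ‖) J :=
    ((hg.mono_set inter_subset_right).sub (integrableOn_const hJfin)).norm
  have h3 : ε * h ≤ ∫ s in J, ‖g s - g τ‖ := by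
    calc ε * h = ∫ _ in Ioo τ (τ + h), ε := by
          rw [setIntegral_const, Real.volume_real_Ioo_of_le (by linarith), smul_eq_mul]; ring
      _ ≤ ∫ s in Ioo τ (τ + h), ‖g s - g τ‖ := by
          refine setIntegral_mono_ae_restrict (integrableOn_const measure_Ioo_lt_top.ne)
            (hi.mono_set hsub) ?_
          refine (ae_restrict_iff' measurableSet_Ioo).2 ?_
          filter_upwards [hae] with s hs hsI
          exact hs ⟨hsI.1, hsI.2.trans (lt_min (by linarith) (by linarith))⟩
      _ ≤ _ := setIntegral_mono_set hi (ae_of_all _ fun _ => norm_nonneg _) hsub.eventuallyLE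
  rw [setAverage_eq, smul_eq_mul, inv_mul_lt_iff₀ (by linarith)] at hlt
  nlinarith

end Measure

/-! ### Uniform bounds and linear approximation on compact sets. -/

section Field

theorem isCompact_closedBall_prod_Icc {E C : Type*} [SeminormedAddCommGroup E]
    [SeminormedAddCommGroup C] [ProperSpace E] [ProperSpace C] (R M T : ℝ) :
    IsCompact ((Metric.closedBall (0 : E) R ×ˢ Metric.closedBall (0 : C) M) ×ˢ Icc 0 T) :=
  ((isCompact_closedBall _ _).prod (isCompact_closedBall _ _)).prod isCompact_Icc

variable {E C : Type*} [NormedAddCommGroup E] [NormedSpace ℝ E] [NormedAddCommGroup C]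

/-- `g : E × C × ℝ → E` is continuous, with a continuous partial differential `G` in its first
variable. -/
structure IsC1Field (g : E → C → ℝ → E) (G : E → C → ℝ → E →L[ℝ] E) : Prop where
  continuous : Continuous fun q : (E × C) × ℝ => g q.1.1 q.1.2 q.2
  continuous_deriv : Continuous fun q : (E × C) × ℝ => G q.1.1 q.1.2 q.2
  hasFDerivAt : ∀ x c t, HasFDerivAt (fun z => g z c t) (G x c t) x

/-- `Λ` bounds `g` and its partial differential on `B(0,R) × B(0,M) × [0,T]`. -/
structure IsFieldBound (g : E → C → ℝ → E) (G : E → C → ℝ → E →L[ℝ] E) (R M T Λ : ℝ) : Prop where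
  pos : 0 < Λ
  norm_le : ∀ x c t, ‖x‖ ≤ R → ‖c‖ ≤ M → t ∈ Icc 0 T → ‖g x c t‖ ≤ Λ
  norm_deriv_le : ∀ x c t, ‖x‖ ≤ R → ‖c‖ ≤ M → t ∈ Icc 0 T → ‖G x c t‖ ≤ Λ

variable {g : E → C → ℝ → E} {G : E → C → ℝ → E →L[ℝ] E}

theorem IsFieldBound.norm_sub_le {R M T Λ : ℝ} (hΛ : IsFieldBound g G R M T Λ)
    (hg : IsC1Field g G) {a b : E} {c : C} {t : ℝ} (ha : ‖a‖ ≤ R) (hb : ‖b‖ ≤ R) (hc : ‖c‖ ≤ M)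
    (ht : t ∈ Icc 0 T) : ‖g a c t - g b c t‖ ≤ Λ * ‖a - b‖ :=
  (convex_closedBall (0 : E) R).norm_image_sub_le_of_norm_hasFDerivWithin_le
    (fun x _ => (hg.hasFDerivAt x c t).hasFDerivWithinAt)
    (fun x hx => hΛ.norm_deriv_le x c t (mem_closedBall_zero_iff.1 hx) hc ht)
    (mem_closedBall_zero_iff.2 hb) (mem_closedBall_zero_iff.2 ha)

variable [ProperSpace E] [ProperSpace C]

theorem IsC1Field.exists_bound (hg : IsC1Field g G) (R M T : ℝ) :
    ∃ Λ, IsFieldBound g G R M T Λ := by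
  obtain ⟨a, ha⟩ := (isCompact_closedBall_prod_Icc (E := E) (C := C) R M T).exists_bound_of_continuousOn
    hg.continuous.continuousOn
  obtain ⟨b, hb⟩ := (isCompact_closedBall_prod_Icc (E := E) (C := C) R M T).exists_bound_of_continuousOn
    hg.continuous_deriv.continuousOn
  refine ⟨max 1 (max a b), by positivity, fun x c t hx hc ht => ?_, fun x c t hx hc ht => ?_⟩
  · exact (ha ((x, c), t) ⟨⟨by simpa using hx, by simpa using hc⟩, ht⟩).trans (by simp)
  · exact (hb ((x, c), t) ⟨⟨by simpa using hx, by simpa using hc⟩, ht⟩).trans (by simp)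

/-- Uniform continuity of `G` on a compact set bounds the differential of `z ↦ g z c t - G x c t z`
near `x`, and the mean value inequality concludes. The compact set has radius `R + 1` so as to
contain the balls around `x`. -/
theorem IsC1Field.exists_linear_approx (hg : IsC1Field g G) (R M T : ℝ) {ε : ℝ} (hε : 0 < ε) :
    ∃ δ > 0, ∀ x c t, ‖x‖ ≤ R → ‖c‖ ≤ M → t ∈ Icc 0 T → ∀ a b, ‖a - x‖ ≤ δ → ‖b - x‖ ≤ δ →
      ‖g a c t - g b c t - G x c t (a - b)‖ ≤ ε * ‖a - b‖ := by
  have huc := (isCompact_closedBall_prod_Icc (E := E) (C := C) (R + 1) M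
    T).uniformContinuousOn_of_continuous hg.continuous_deriv.continuousOn
  obtain ⟨δ, hδ, H⟩ := Metric.uniformContinuousOn_iff.1 huc ε hε
  refine ⟨min 1 (δ / 2), by positivity, fun x c t hx hc ht a b ha hb => ?_⟩
  refine (convex_closedBall x (min 1 (δ / 2))).norm_image_sub_le_of_norm_hasFDerivWithin_le'
    (fun y _ => (hg.hasFDerivAt y c t).hasFDerivWithinAt) (fun y hy => ?_)
    (mem_closedBall_iff_norm.2 hb) (mem_closedBall_iff_norm.2 ha)
  have hyx := mem_closedBall_iff_norm.1 hy
  have hy1 : ‖y‖ ≤ R + 1 := by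
    have : ‖y‖ ≤ ‖y - x‖ + ‖x‖ := by simpa using norm_add_le (y - x) x
    linarith [hyx.trans (min_le_left _ _)]
  have := H ((y, c), t) ⟨⟨by simpa using hy1, by simpa using hc⟩, ht⟩
    ((x, c), t) ⟨⟨mem_closedBall_zero_iff.2 (by linarith), by simpa using hc⟩, ht⟩ (by
      rw [dist_prod_same_right, dist_prod_same_right, dist_eq_norm]
      linarith [hyx.trans (min_le_right _ _)])
  rw [dist_eq_norm] at this
  exact this.le

end Field

/-! ### Trajectories: integral form and uniqueness. -/

section Trajectory

variable {E C : Type*} [NormedAddCommGroup E] [NormedSpace ℝ E]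

/-- `x` is an absolutely continuous solution of `x' = g(x,v,t)` on `[0,T]`. -/
def IsTrajectory (T : ℝ) (g : E → C → ℝ → E) (x : ℝ → E) (v : ℝ → C) : Prop :=
  AbsolutelyContinuousOnInterval x 0 T ∧ ∀ᵐ t ∂(timeMeasure T), HasDerivAt x (g (x t) (v t) t) t

variable {g : E → C → ℝ → E} {x y : ℝ → E} {v : ℝ → C} {T : ℝ}

theorem ae_timeMeasure_mem_Ioo (T : ℝ) : ∀ᵐ t ∂(timeMeasure T), t ∈ Ioo 0 T := by
  rw [timeMeasure, Measure.restrict_congr_set Ioo_ae_eq_Icc.symm]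
  exact ae_restrict_mem measurableSet_Ioo

theorem IsTrajectory.congr (hT : 0 ≤ T) (hx : IsTrajectory T g x v) (h : EqOn y x (Icc 0 T)) :
    IsTrajectory T g y v := by
  refine ⟨hx.1.congr (by rwa [uIcc_of_le hT]), ?_⟩
  filter_upwards [hx.2, ae_timeMeasure_mem_Ioo T] with t ht htI
  rw [h (Ioo_subset_Icc_self htI)]
  refine ht.congr_of_eventuallyEq ?_
  filter_upwards [Ioo_mem_nhds htI.1 htI.2] with s hs using h (Ioo_subset_Icc_self hs)

theorem IsTrajectory.congr_control {g' : E → C → ℝ → E} {v' : ℝ → C} (hx : IsTrajectory T g x v)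
    (hv : v' =ᵐ[timeMeasure T] v) (hg : ∀ a c, ∀ t ∈ Icc 0 T, g' a c t = g a c t) :
    IsTrajectory T g' x v' := by
  refine ⟨hx.1, ?_⟩
  filter_upwards [hx.2, hv, ae_restrict_mem measurableSet_Icc] with t ht hvt htI
  rwa [hvt, hg _ _ _ htI]

theorem IsTrajectory.continuousOn (hT : 0 ≤ T) (hx : IsTrajectory T g x v) :
    ContinuousOn x (Icc 0 T) := by
  simpa [uIcc_of_le hT] using hx.1.continuousOn

theorem IsC1Field.intervalIntegrable [NormedAddCommGroup C] {G : E → C → ℝ → E →L[ℝ] E}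
    [SecondCountableTopology E] [SecondCountableTopology C]
    [MeasurableSpace C] [BorelSpace C] (hg : IsC1Field g G) {R M Λ : ℝ} (hT : 0 ≤ T)
    (hΛ : IsFieldBound g G R M T Λ) (hx : Continuous x) (hxR : ∀ s ∈ Icc 0 T, ‖x s‖ ≤ R)
    (hv : Measurable v) (hvM : ∀ s, ‖v s‖ ≤ M) :
    IntervalIntegrable (fun s => g (x s) (v s) s) volume 0 T := by
  borelize E
  rw [intervalIntegrable_iff_integrableOn_Icc_of_le hT]
  refine Integrable.mono' (g := fun _ => Λ) (integrableOn_const measure_Icc_lt_top.ne) ?_ ?_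
  · exact (hg.continuous.measurable.comp
      ((hx.measurable.prodMk hv).prodMk measurable_id)).aestronglyMeasurable
  · filter_upwards [ae_restrict_mem measurableSet_Icc] with s hs
    exact hΛ.norm_le _ _ _ (hxR s hs) (hvM s) hs

variable [CompleteSpace E]

theorem IsTrajectory.of_eq_add_integral (hT : 0 ≤ T) {x₀ : E}
    (hi : IntervalIntegrable (fun s => g (x s) (v s) s) volume 0 T)
    (hx : ∀ t ∈ Icc 0 T, x t = x₀ + ∫ s in 0..t, g (x s) (v s) s) : IsTrajectory T g x v := by
  constructor
  · refine (absolutelyContinuousOnInterval_integral hi).of_dist_le fun s hs t ht => ?_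
    rw [uIcc_of_le hT] at hs ht
    rw [hx s hs, hx t ht, dist_add_left]
  · filter_upwards [ae_restrict_of_ae hi.ae_hasDerivAt_integral, ae_timeMeasure_mem_Ioo T]
      with t ht htI
    have := ht (by rw [uIcc_of_le hT]; exact Ioo_subset_Icc_self htI) 0 left_mem_uIcc
    refine (this.const_add x₀).congr_of_eventuallyEq ?_
    filter_upwards [Ioo_mem_nhds htI.1 htI.2] with s hs using hx s (Ioo_subset_Icc_self hs)

/-- Both solutions stay in a common ball, where the field is Lipschitz in the state, so Grönwall
with zero forcing applies. This identifies the trajectory obtained by choice in `trajectory` with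
the constructed one. -/
theorem IsTrajectory.eqOn {G : E → C → ℝ → E →L[ℝ] E} [NormedAddCommGroup C] [ProperSpace E] [ProperSpace C] (hg : IsC1Field g G) (hT : 0 ≤ T) {M : ℝ}
    (hv : ∀ᵐ t ∂(timeMeasure T), ‖v t‖ ≤ M) (hx : IsTrajectory T g x v) (hy : IsTrajectory T g y v)
    (h0 : x 0 = y 0) : EqOn x y (Icc 0 T) := by
  obtain ⟨a, ha⟩ := isCompact_Icc.exists_bound_of_continuousOn (hx.continuousOn hT)
  obtain ⟨b, hb⟩ := isCompact_Icc.exists_bound_of_continuousOn (hy.continuousOn hT)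
  obtain ⟨Λ, hΛ⟩ := hg.exists_bound (max a b) M T
  have hd : ∀ᵐ t ∂(timeMeasure T),
      HasDerivAt (fun t => x t - y t) (g (x t) (v t) t - g (y t) (v t) t) t := by
    filter_upwards [hx.2, hy.2] with t h1 h2 using h1.sub h2
  intro t ht
  have := AbsolutelyContinuousOnInterval.norm_le_mul_exp (ρ := fun _ => 0) hT hΛ.pos.le
    (hx.1.sub hy.1) (by simp [h0]) hd (by simp) (fun _ => le_rfl) (by
      filter_upwards [hv, ae_restrict_mem measurableSet_Icc] with s hs hsI
      simpa using hΛ.norm_sub_le hg ((ha s hsI).trans (le_max_left _ _))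
        ((hb s hsI).trans (le_max_right _ _)) hs hsI) ht
  simpa [sub_eq_zero] using this

end Trajectory

/-! ### Indicator functions and needle controls. -/

section Needle

/-- The indicator function of a set, with values in `ℝ`. -/
noncomputable abbrev realInd (A : Set ℝ) : ℝ → ℝ := A.indicator 1

theorem realInd_nonneg (A : Set ℝ) (s : ℝ) : 0 ≤ realInd A s :=
  indicator_nonneg (fun _ _ => zero_le_one) s

theorem intervalIntegrable_realInd {A : Set ℝ} (hA : MeasurableSet A) (a b : ℝ) :
    IntervalIntegrable (realInd A) volume a b :=
  (intervalIntegrable_const (c := (1 : ℝ))).mono_fun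
    ((measurable_one.indicator hA).aestronglyMeasurable) (ae_of_all _ fun s => by
      by_cases h : s ∈ A <;> simp [realInd, h])

theorem integral_realInd {A : Set ℝ} (hA : MeasurableSet A) {T : ℝ} (hT : 0 ≤ T)
    (hAT : A ⊆ Ioc 0 T) : ∫ s in 0..T, realInd A s = volume.real A := by
  rw [intervalIntegral.integral_of_le hT, integral_indicator_one hA,
    measureReal_restrict_apply hA, inter_eq_left.2 hAT]

theorem integral_abs_realInd_sub {A B : Set ℝ} (hA : MeasurableSet A) (hB : MeasurableSet B) {T : ℝ}
    (hT : 0 ≤ T) (hAT : A ⊆ Ioc 0 T) (hBT : B ⊆ Ioc 0 T) (hAB : A ⊆ B ∨ B ⊆ A) :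
    ∫ s in 0..T, |realInd A s - realInd B s| = |volume.real A - volume.real B| := by
  wlog h : A ⊆ B generalizing A B
  · rw [abs_sub_comm, ← this hB hA hBT hAT hAB.symm (hAB.resolve_left h)]
    exact intervalIntegral.integral_congr fun s _ => abs_sub_comm _ _
  have h1 : ∀ s, |realInd A s - realInd B s| = realInd B s - realInd A s := fun s => by
    rw [abs_sub_comm, abs_of_nonneg]
    exact sub_nonneg.2 (indicator_le_indicator_of_subset h (fun _ => zero_le_one) s)
  have h2 : volume.real A ≤ volume.real B :=
    measureReal_mono h ((measure_mono hBT).trans_lt measure_Ioc_lt_top).ne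
  simp only [h1]
  rw [intervalIntegral.integral_sub (intervalIntegrable_realInd hB _ _)
    (intervalIntegrable_realInd hA _ _), integral_realInd hA hT hAT, integral_realInd hB hT hBT,
    abs_sub_comm, abs_of_nonneg (sub_nonneg.2 h2)]

variable {ι C : Type*} [Fintype ι] [NormedAddCommGroup C] [NormedSpace ℝ C]

/-- The control `v` modified to take the value `ω i` on `A i`. -/
noncomputable def needleControl (v : ℝ → C) (ω : ι → C) (A : ι → Set ℝ) (s : ℝ) : C :=
  v s + ∑ i, realInd (A i) s • (ω i - v s)

theorem measurable_needleControl [MeasurableSpace C] [BorelSpace C] [SecondCountableTopology C]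
    {v : ℝ → C} (hv : Measurable v) (ω : ι → C) {A : ι → Set ℝ} (hA : ∀ i, MeasurableSet (A i)) :
    Measurable (needleControl v ω A) := by
  refine hv.add (Finset.measurable_sum _ fun i _ => ?_)
  exact (measurable_one.indicator (hA i)).smul (measurable_const.sub hv)

theorem sum_realInd_smul_of_mem {F : Type*} [NormedAddCommGroup F] [NormedSpace ℝ F]
    {A : ι → Set ℝ} (hA : Pairwise (Function.onFun Disjoint A)) {s : ℝ} {i : ι} (hs : s ∈ A i)
    (φ : ι → F) : ∑ j, realInd (A j) s • φ j = φ i := by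
  classical
  rw [Finset.sum_eq_single i]
  · simp [realInd, hs]
  · intro j _ hj
    have : s ∉ A j := disjoint_left.1 (hA hj.symm) hs
    simp [realInd, this]
  · simp

theorem needleControl_of_mem {v : ℝ → C} {ω : ι → C} {A : ι → Set ℝ}
    (hA : Pairwise (Function.onFun Disjoint A)) {s : ℝ} {i : ι} (hs : s ∈ A i) :
    needleControl v ω A s = ω i := by
  rw [needleControl, sum_realInd_smul_of_mem hA hs (fun j => ω j - v s)]; abel

theorem needleControl_of_forall_notMem {v : ℝ → C} {ω : ι → C} {A : ι → Set ℝ} {s : ℝ}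
    (hs : ∀ i, s ∉ A i) : needleControl v ω A s = v s := by
  simp [needleControl, realInd, hs]

theorem needleControl_eq_or {v : ℝ → C} {ω : ι → C} {A : ι → Set ℝ}
    (hA : Pairwise (Function.onFun Disjoint A)) (s : ℝ) :
    needleControl v ω A s = v s ∨ ∃ i, needleControl v ω A s = ω i := by
  by_cases h : ∃ i, s ∈ A i
  · obtain ⟨i, hi⟩ := h
    exact Or.inr ⟨i, needleControl_of_mem hA hi⟩
  · push Not at h
    exact Or.inl (needleControl_of_forall_notMem h)

theorem norm_needleControl_le {v : ℝ → C} {ω : ι → C} {A : ι → Set ℝ} {M : ℝ}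
    (hA : Pairwise (Function.onFun Disjoint A)) (hv : ∀ s, ‖v s‖ ≤ M) (hω : ∀ i, ‖ω i‖ ≤ M)
    (s : ℝ) : ‖needleControl v ω A s‖ ≤ M := by
  rcases needleControl_eq_or (v := v) (ω := ω) hA s with h | ⟨i, h⟩ <;> rw [h]
  exacts [hv s, hω i]

/-- Disjointness makes any function of the control, however nonlinear, affine in the indicators; no
regularity in the control variable is then needed. -/
theorem map_needleControl {F : Type*} [NormedAddCommGroup F] [NormedSpace ℝ F] {v : ℝ → C}
    {ω : ι → C} {A : ι → Set ℝ} (hA : Pairwise (Function.onFun Disjoint A)) (φ : C → F) (s : ℝ) :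
    φ (needleControl v ω A s) = φ (v s) + ∑ i, realInd (A i) s • (φ (ω i) - φ (v s)) := by
  by_cases h : ∃ i, s ∈ A i
  · obtain ⟨i, hi⟩ := h
    rw [needleControl_of_mem hA hi, sum_realInd_smul_of_mem hA hi (fun j => φ (ω j) - φ (v s))]
    abel
  · push Not at h
    rw [needleControl_of_forall_notMem h]
    simp [realInd, h]

theorem map_needleControl_sub {F : Type*} [NormedAddCommGroup F] [NormedSpace ℝ F] {v : ℝ → C}
    {ω : ι → C} {P Q : ι → Set ℝ} (hP : Pairwise (Function.onFun Disjoint P))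
    (hQ : Pairwise (Function.onFun Disjoint Q)) (φ : C → F) (s : ℝ) :
    φ (needleControl v ω P s) - φ (needleControl v ω Q s) =
      ∑ i, (realInd (P i) s - realInd (Q i) s) • (φ (ω i) - φ (v s)) := by
  rw [map_needleControl hP φ, map_needleControl hQ φ, add_sub_add_left_eq_sub,
    ← Finset.sum_sub_distrib]
  simp only [sub_smul]

end Needle

/-! ### Effect of needles on trajectories: Lipschitz and first-order estimates. -/

section Perturbation

/-- The bound is asked only where the coefficient is nonzero, because the needle estimates hold only
on the needles themselves. -/
theorem norm_sum_smul_le_of_norm_le {ι E : Type*} [Fintype ι] [NormedAddCommGroup E]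
    [NormedSpace ℝ E] {c : ι → ℝ} {φ : ι → E} {b : ℝ}
    (h : ∀ i, c i ≠ 0 → ‖φ i‖ ≤ b) : ‖∑ i, c i • φ i‖ ≤ (∑ i, |c i|) * b := by
  rw [Finset.sum_mul]
  refine (norm_sum_le _ _).trans (Finset.sum_le_sum fun i _ => ?_)
  rw [norm_smul, Real.norm_eq_abs]
  by_cases hi : c i = 0
  · simp [hi]
  · exact mul_le_mul_of_nonneg_left (h i hi) (abs_nonneg _)

variable {ι E C : Type*} [Fintype ι] [NormedAddCommGroup E] [NormedSpace ℝ E]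
  [FiniteDimensional ℝ E] [NormedAddCommGroup C] [NormedSpace ℝ C]
  {g : E → C → ℝ → E} {G : E → C → ℝ → E →L[ℝ] E} {R M T Λ ρ : ℝ} {xb xP xQ : ℝ → E} {v : ℝ → C}
  {ω : ι → C} {P Q : ι → Set ℝ}

/-- The trajectory depends on the control in a Lipschitz way with respect to the measure of the
set where the control is modified. -/
theorem norm_sub_le_of_needleControl (hg : IsC1Field g G) (hT : 0 ≤ T)
    (hΛ : IsFieldBound g G R M T Λ) (hv : ∀ s, ‖v s‖ ≤ M) (hω : ∀ i, ‖ω i‖ ≤ M)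
    (hPm : ∀ i, MeasurableSet (P i)) (hQm : ∀ i, MeasurableSet (Q i))
    (hP : Pairwise (Function.onFun Disjoint P)) (hQ : Pairwise (Function.onFun Disjoint Q))
    (hxP : IsTrajectory T g xP (needleControl v ω P))
    (hxQ : IsTrajectory T g xQ (needleControl v ω Q)) (h0 : xP 0 = xQ 0)
    (hPR : ∀ t ∈ Icc 0 T, ‖xP t‖ ≤ R) (hQR : ∀ t ∈ Icc 0 T, ‖xQ t‖ ≤ R) {t : ℝ}
    (ht : t ∈ Icc 0 T) :
    ‖xP t - xQ t‖ ≤ 2 * Λ * Real.exp (Λ * T) *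
      ∑ i, ∫ s in 0..T, |realInd (P i) s - realInd (Q i) s| := by
  have := FiniteDimensional.complete ℝ E
  have hint : ∀ i, IntervalIntegrable (fun s => |realInd (P i) s - realInd (Q i) s|) volume 0 T :=
    fun i => ((intervalIntegrable_realInd (hPm i) _ _).sub
      (intervalIntegrable_realInd (hQm i) _ _)).norm
  have hint' : IntervalIntegrable (fun s => ∑ i, |realInd (P i) s - realInd (Q i) s|) volume 0 T :=
    by simpa only [Finset.sum_fn] using IntervalIntegrable.sum Finset.univ fun i _ => hint i
  have hd : ∀ᵐ t ∂(timeMeasure T), HasDerivAt (fun t => xP t - xQ t)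
      (g (xP t) (needleControl v ω P t) t - g (xQ t) (needleControl v ω Q t) t) t := by
    filter_upwards [hxP.2, hxQ.2] with t h1 h2 using h1.sub h2
  have := AbsolutelyContinuousOnInterval.norm_le_mul_exp (T := T) (Λ := Λ)
    (ρ := fun s => (∑ i, |realInd (P i) s - realInd (Q i) s|) * (2 * Λ)) hT hΛ.pos.le
    (hxP.1.sub hxQ.1) (by simp [h0]) hd (hint'.mul_const _)
    (fun s => mul_nonneg (Finset.sum_nonneg fun i _ => abs_nonneg _) (by linarith [hΛ.pos])) (by
      filter_upwards [ae_restrict_mem measurableSet_Icc] with s hs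
      have h1 := hΛ.norm_sub_le hg (hPR s hs) (hQR s hs)
        (norm_needleControl_le hP hv hω s) hs
      have h2 := map_needleControl_sub (v := v) (ω := ω) hP hQ (fun c => g (xQ s) c s) s
      have h3 : ‖∑ i, (realInd (P i) s - realInd (Q i) s) • (g (xQ s) (ω i) s - g (xQ s) (v s) s)‖
          ≤ (∑ i, |realInd (P i) s - realInd (Q i) s|) * (2 * Λ) := by
        refine norm_sum_smul_le_of_norm_le fun i _ => (norm_sub_le _ _).trans ?_
        linarith [hΛ.norm_le _ _ _ (hQR s hs) (hω i) hs, hΛ.norm_le _ _ _ (hQR s hs) (hv s) hs]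
      rw [← h2] at h3
      calc _ = ‖(g (xP s) (needleControl v ω P s) s - g (xQ s) (needleControl v ω P s) s) +
            (g (xQ s) (needleControl v ω P s) s - g (xQ s) (needleControl v ω Q s) s)‖ := by
            congr 1; abel
        _ ≤ _ := (norm_add_le _ _).trans (add_le_add h1 h3)) ht
  refine this.trans (le_of_eq ?_)
  rw [intervalIntegral.integral_mul_const, intervalIntegral.integral_finsetSum fun i _ => hint i]
  ring

/-- First-order expansion of the difference of two trajectories whose controls differ from the
reference one on small sets where the variation of the dynamics is close to the value of a
solution of the linearized equation. -/
theorem norm_sub_sub_sum_le_of_needleControl (hg : IsC1Field g G) (hT : 0 ≤ T)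
    (hΛ : IsFieldBound g G R M T Λ) (hv : ∀ s, ‖v s‖ ≤ M) (hω : ∀ i, ‖ω i‖ ≤ M)
    (hPm : ∀ i, MeasurableSet (P i)) (hQm : ∀ i, MeasurableSet (Q i))
    (hP : Pairwise (Function.onFun Disjoint P)) (hQ : Pairwise (Function.onFun Disjoint Q))
    (hxP : IsTrajectory T g xP (needleControl v ω P))
    (hxQ : IsTrajectory T g xQ (needleControl v ω Q)) (h0 : xP 0 = xQ 0)
    (hbR : ∀ t ∈ Icc 0 T, ‖xb t‖ ≤ R)
    (hPR : ∀ t ∈ Icc 0 T, ‖xP t‖ ≤ R) (hQR : ∀ t ∈ Icc 0 T, ‖xQ t‖ ≤ R)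
    (hQb : ∀ t ∈ Icc 0 T, ‖xQ t - xb t‖ ≤ ρ)
    {ε₂ : ℝ} (hε₂ : 0 ≤ ε₂) (hlin : ∀ t ∈ Icc 0 T,
      ‖g (xP t) (v t) t - g (xQ t) (v t) t - G (xb t) (v t) t (xP t - xQ t)‖
        ≤ ε₂ * ‖xP t - xQ t‖)
    {τ : ι → ℝ} {W : ι → ℝ → E} (hWac : ∀ i, AbsolutelyContinuousOnInterval (W i) 0 T)
    (hW : ∀ i, ∀ᵐ t ∂(timeMeasure T), ∃ K, HasDerivAt (W i) K t ∧
      (τ i < t → K = G (xb t) (v t) t (W i t)))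
    (hPT : ∀ i, P i ⊆ Ioc (τ i) T) (hQT : ∀ i, Q i ⊆ Ioc (τ i) T)
    (hPT₀ : ∀ i, P i ⊆ Ioc 0 T) (hQT₀ : ∀ i, Q i ⊆ Ioc 0 T)
    {ε₁ : ℝ} (hε₁ : 0 ≤ ε₁) (hB : ∀ i, ∀ t ∈ P i ∪ Q i,
      ‖g (xb t) (ω i) t - g (xb t) (v t) t - W i t‖ ≤ ε₁) :
    ‖xP T - xQ T - ∑ i, (volume.real (P i) - volume.real (Q i)) • W i T‖ ≤
      (ε₁ + 2 * Λ * ρ + (ε₂ * T + 2 * Λ * ∑ i, volume.real (P i)) * (2 * Λ * Real.exp (Λ * T))) *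
        Real.exp (Λ * T) * ∑ i, ∫ s in 0..T, |realInd (P i) s - realInd (Q i) s| := by
  have := FiniteDimensional.complete ℝ E
  set χ : ι → ℝ → ℝ := fun i s => realInd (P i) s - realInd (Q i) s with hχ
  set S := ∑ i, ∫ s in 0..T, |χ i s| with hS
  set D := 2 * Λ * Real.exp (Λ * T) * S with hD
  have hΛ0 := hΛ.pos
  have hρ : 0 ≤ ρ := (norm_nonneg _).trans (hQb 0 (left_mem_Icc.2 hT))
  have hS0 : 0 ≤ S := Finset.sum_nonneg fun i _ =>
    intervalIntegral.integral_nonneg hT fun s _ => abs_nonneg _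
  have hD0 : 0 ≤ D := by positivity
  have hdD : ∀ t ∈ Icc 0 T, ‖xP t - xQ t‖ ≤ D := fun t ht =>
    norm_sub_le_of_needleControl hg hT hΛ hv hω hPm hQm hP hQ hxP hxQ h0 hPR hQR ht
  have hχi : ∀ i, IntervalIntegrable (χ i) volume 0 T := fun i =>
    (intervalIntegrable_realInd (hPm i) _ _).sub (intervalIntegrable_realInd (hQm i) _ _)
  have hχs : IntervalIntegrable (fun s => ∑ i, |χ i s|) volume 0 T := by
    simpa only [Finset.sum_fn] using IntervalIntegrable.sum Finset.univ fun i _ => (hχi i).abs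
  have hPs : IntervalIntegrable (fun s => ∑ i, |realInd (P i) s|) volume 0 T := by
    simpa only [Finset.sum_fn] using IntervalIntegrable.sum Finset.univ
      fun i _ => (intervalIntegrable_realInd (hPm i) 0 T).abs
  have hχmem : ∀ i s, χ i s ≠ 0 → s ∈ P i ∪ Q i := by
    intro i s h
    by_contra hs
    simp only [mem_union, not_or] at hs
    exact h (by simp [hχ, realInd, hs.1, hs.2])
  let p : ι → ℝ → ℝ := fun i t => ∫ s in 0..t, χ i s
  -- Before `τ i` the extended `W i` need not solve the linearized equation; its weight `p i`
  -- vanishes there.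
  have hp0 : ∀ i, ∀ t ∈ Icc 0 T, t ≤ τ i → p i t = 0 := by
    intro i t ht hti
    refine intervalIntegral.integral_zero_ae (ae_of_all _ fun s hs => ?_)
    rw [uIoc_of_le ht.1] at hs
    by_contra hne
    rcases hχmem i s hne with h | h
    · exact absurd (hPT i h).1 (not_lt.2 (hs.2.trans hti))
    · exact absurd (hQT i h).1 (not_lt.2 (hs.2.trans hti))
  have hpT : ∀ i, p i T = volume.real (P i) - volume.real (Q i) := fun i => by
    simp only [p, hχ]
    rw [intervalIntegral.integral_sub (intervalIntegrable_realInd (hPm i) _ _)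
      (intervalIntegrable_realInd (hQm i) _ _), integral_realInd (hPm i) hT (hPT₀ i),
      integral_realInd (hQm i) hT (hQT₀ i)]
  -- The first-order remainder: each needle is credited with `W i` in proportion to the net measure
  -- used so far. It solves the linearized equation up to the error `r`.
  let e : ℝ → E := fun t => xP t - xQ t - ∑ i, p i t • W i t
  have heac : AbsolutelyContinuousOnInterval e 0 T :=
    (hxP.1.sub hxQ.1).sub (AbsolutelyContinuousOnInterval.fun_sum _ fun i _ =>
      (absolutelyContinuousOnInterval_integral (hχi i)).smul (hWac i))
  have he0 : e 0 = 0 := by simp [e, p, h0]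
  let k : ℝ → E := fun t => g (xP t) (needleControl v ω P t) t -
    g (xQ t) (needleControl v ω Q t) t -
      ∑ i, (χ i t • W i t + p i t • G (xb t) (v t) t (W i t))
  have hek : ∀ᵐ t ∂(timeMeasure T), HasDerivAt e (k t) t := by
    have hW' := ae_all_iff.2 hW
    have hp' : ∀ᵐ t ∂(timeMeasure T), ∀ i, HasDerivAt (p i) (χ i t) t := by
      refine ae_all_iff.2 fun i => ?_
      filter_upwards [ae_restrict_of_ae (hχi i).ae_hasDerivAt_integral,
        ae_restrict_mem measurableSet_Icc] with t h1 h2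
      exact h1 (by rwa [uIcc_of_le hT]) 0 left_mem_uIcc
    filter_upwards [hxP.2, hxQ.2, hW', hp', ae_restrict_mem measurableSet_Icc] with t h1 h2 h3 h4 ht
    refine (h1.sub h2).sub (HasDerivAt.fun_sum fun i _ => ?_)
    obtain ⟨K, hK, hKe⟩ := h3 i
    refine ((h4 i).smul hK).congr_deriv ?_
    rw [add_comm]
    congr 1
    rcases lt_or_ge (τ i) t with h | h
    · rw [hKe h]
    · rw [hp0 i t ht h, zero_smul, zero_smul]
  let r : ℝ → ℝ := fun s =>
    (∑ i, |χ i s|) * (ε₁ + 2 * Λ * ρ) + (ε₂ * D + (∑ i, |realInd (P i) s|) * (2 * Λ * D))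
  have hri : IntervalIntegrable r volume 0 T :=
    (hχs.mul_const _).add (intervalIntegrable_const.add (hPs.mul_const _))
  have hkr : ∀ᵐ t ∂(timeMeasure T), ‖k t‖ ≤ Λ * ‖e t‖ + r t := by
    filter_upwards [ae_restrict_mem measurableSet_Icc] with t ht
    -- Besides the linear term there are three errors: the mismatch between jump and `W i` on the
    -- needles, the nonlinearity of `g` in the state, and the interaction of the needles `P` with
    -- the deviation `xP - xQ`, small because `P` has small measure.
    have hk : k t = G (xb t) (v t) t (e t) +
        ((∑ i, χ i t • (g (xQ t) (ω i) t - g (xQ t) (v t) t - W i t)) +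
        ((g (xP t) (v t) t - g (xQ t) (v t) t - G (xb t) (v t) t (xP t - xQ t)) +
        ∑ i, realInd (P i) t • ((g (xP t) (ω i) t - g (xQ t) (ω i) t) -
          (g (xP t) (v t) t - g (xQ t) (v t) t)))) := by
      have e1 := map_needleControl (v := v) (ω := ω) hP (fun c => g (xP t) c t) t
      have e2 := map_needleControl (v := v) (ω := ω) hQ (fun c => g (xQ t) c t) t
      simp only [k, e, e1, e2, map_sub, map_sum, map_smul, hχ, smul_sub, sub_smul,
        Finset.sum_add_distrib, Finset.sum_sub_distrib]
      abel
    have b1 : ‖G (xb t) (v t) t (e t)‖ ≤ Λ * ‖e t‖ :=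
      (ContinuousLinearMap.le_opNorm _ _).trans (mul_le_mul_of_nonneg_right
        (hΛ.norm_deriv_le _ _ _ (hbR t ht) (hv t) ht) (norm_nonneg _))
    have b2 : ‖∑ i, χ i t • (g (xQ t) (ω i) t - g (xQ t) (v t) t - W i t)‖
        ≤ (∑ i, |χ i t|) * (ε₁ + 2 * Λ * ρ) := by
      refine norm_sum_smul_le_of_norm_le fun i hi => ?_
      have c1 := hB i t (hχmem i t hi)
      have c2 := hΛ.norm_sub_le hg (hQR t ht) (hbR t ht) (hω i) ht
      have c3 := hΛ.norm_sub_le hg (hQR t ht) (hbR t ht) (hv t) ht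
      have c4 := mul_le_mul_of_nonneg_left (hQb t ht) hΛ0.le
      calc _ = ‖(g (xb t) (ω i) t - g (xb t) (v t) t - W i t) +
            ((g (xQ t) (ω i) t - g (xb t) (ω i) t) - (g (xQ t) (v t) t - g (xb t) (v t) t))‖ := by
            congr 1; abel
        _ ≤ _ := (norm_add_le _ _).trans (add_le_add_right (norm_sub_le _ _) _)
        _ ≤ _ := by linarith
    have b3 : ‖g (xP t) (v t) t - g (xQ t) (v t) t - G (xb t) (v t) t (xP t - xQ t)‖ ≤ ε₂ * D :=
      (hlin t ht).trans (mul_le_mul_of_nonneg_left (hdD t ht) hε₂)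
    have b4 : ‖∑ i, realInd (P i) t • ((g (xP t) (ω i) t - g (xQ t) (ω i) t) -
          (g (xP t) (v t) t - g (xQ t) (v t) t))‖ ≤ (∑ i, |realInd (P i) t|) * (2 * Λ * D) := by
      refine norm_sum_smul_le_of_norm_le fun i _ => (norm_sub_le _ _).trans ?_
      have c2 := hΛ.norm_sub_le hg (hPR t ht) (hQR t ht) (hω i) ht
      have c3 := hΛ.norm_sub_le hg (hPR t ht) (hQR t ht) (hv t) ht
      have c4 := mul_le_mul_of_nonneg_left (hdD t ht) hΛ0.le
      linarith
    rw [hk]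
    exact (norm_add_le _ _).trans (add_le_add b1 ((norm_add_le _ _).trans (add_le_add b2
      ((norm_add_le _ _).trans (add_le_add b3 b4)))))
  have hr0 : ∀ t, 0 ≤ r t := fun t => by positivity
  have := heac.norm_le_mul_exp hT hΛ0.le he0 hek hri hr0 hkr (right_mem_Icc.2 hT)
  have hint : ∫ s in 0..T, r s = S * (ε₁ + 2 * Λ * ρ) +
      (ε₂ * D * T + (∑ i, volume.real (P i)) * (2 * Λ * D)) := by
    simp only [r]
    rw [intervalIntegral.integral_add (hχs.mul_const _)
      (intervalIntegrable_const.add (hPs.mul_const _)),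
      intervalIntegral.integral_add intervalIntegrable_const (hPs.mul_const _),
      intervalIntegral.integral_mul_const, intervalIntegral.integral_mul_const,
      intervalIntegral.integral_mul_const,
      intervalIntegral.integral_finsetSum fun i _ => (hχi i).abs,
      intervalIntegral.integral_finsetSum fun i _ => (intervalIntegrable_realInd (hPm i) 0 T).abs]
    simp only [abs_of_nonneg (realInd_nonneg _ _), integral_realInd (hPm _) hT (hPT₀ _)]
    simp only [hS, intervalIntegral.integral_const, sub_zero, smul_eq_mul]
    ring
  rw [hint] at this
  simp only [e, hpT] at this
  refine this.trans (le_of_eq ?_)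
  rw [hD]; ring

end Perturbation

/-! ### Construction of the needle family. -/

section NeedleFamily

variable {ι E C : Type*} [Fintype ι] [NormedAddCommGroup E] [NormedSpace ℝ E]
  [FiniteDimensional ℝ E] [NormedAddCommGroup C]
  {g : E → C → ℝ → E} {G : E → C → ℝ → E →L[ℝ] E} {R M T Λ : ℝ} {xb : ℝ → E} {v : ℝ → C}
  {ω : ι → C}

/-- A solution of the linearized equation on `[τ,T]`, extended by a constant before `τ`. -/
theorem exists_extension_of_linearized (hΛ : IsFieldBound g G R M T Λ)
    (hv : ∀ s, ‖v s‖ ≤ M) (hbR : ∀ t ∈ Icc 0 T, ‖xb t‖ ≤ R) {τ : ℝ} (hτ : τ ∈ Ico 0 T) {w : ℝ → E}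
    (hw : AbsolutelyContinuousOnInterval w τ T)
    (hwd : ∀ᵐ t ∂(volume.restrict (Icc τ T)), HasDerivAt w (G (xb t) (v t) t (w t)) t) :
    ∃ W : ℝ → E, Continuous W ∧ AbsolutelyContinuousOnInterval W 0 T ∧ W τ = w τ ∧ W T = w T ∧
      ∀ᵐ t ∂(timeMeasure T), ∃ K, HasDerivAt W K t ∧ (τ < t → K = G (xb t) (v t) t (W t)) := by
  have := FiniteDimensional.complete ℝ E
  have hwc : ContinuousOn w (Icc τ T) := by simpa [uIcc_of_le hτ.2.le] using hw.continuousOn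
  obtain ⟨b, hb⟩ := isCompact_Icc.exists_bound_of_continuousOn hwc
  have hb0 : 0 ≤ b := (norm_nonneg _).trans (hb τ (left_mem_Icc.2 hτ.2.le))
  -- A bounded solution of the linear equation is Lipschitz, so composing it with the clamp onto
  -- `[τ,T]` stays Lipschitz, hence absolutely continuous.
  have hLip : LipschitzOnWith (Λ * b).toNNReal w (Icc τ T) := by
    refine hw.lipschitzOnWith hτ.2.le hwd ?_
    filter_upwards [ae_restrict_mem measurableSet_Icc] with t ht
    rw [Real.coe_toNNReal _ (mul_nonneg hΛ.pos.le hb0)]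
    have ht' : t ∈ Icc 0 T := ⟨hτ.1.trans ht.1, ht.2⟩
    exact (ContinuousLinearMap.le_opNorm _ _).trans (mul_le_mul
      (hΛ.norm_deriv_le _ _ _ (hbR t ht') (hv t) ht') (hb t ht) (norm_nonneg _) hΛ.pos.le)
  let W : ℝ → E := fun t => w (projIcc τ T hτ.2.le t)
  have hWL : LipschitzWith ((Λ * b).toNNReal * 1) W :=
    (lipschitzOnWith_iff_restrict.1 hLip).comp (LipschitzWith.projIcc hτ.2.le)
  have hWw : ∀ t ∈ Icc τ T, W t = w t := fun t ht => by simp [W, projIcc_of_mem _ ht]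
  refine ⟨W, hWL.continuous, hWL.lipschitzOnWith.absolutelyContinuousOnInterval,
    hWw _ (left_mem_Icc.2 hτ.2.le), hWw _ (right_mem_Icc.2 hτ.2.le), ?_⟩
  have h1 : ∀ᵐ t ∂(timeMeasure T), t ≠ τ :=
    ae_restrict_of_ae (by simp [ae_iff, measure_singleton])
  have h2 : ∀ᵐ t ∂(timeMeasure T), t ∈ Icc τ T → HasDerivAt w (G (xb t) (v t) t (w t)) t :=
    ae_restrict_of_ae ((ae_restrict_iff' measurableSet_Icc).1 hwd)
  filter_upwards [h1, h2, ae_timeMeasure_mem_Ioo T] with t htτ htd htI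
  rcases lt_or_gt_of_ne htτ with h | h
  · refine ⟨0, (hasDerivAt_const t (w τ)).congr_of_eventuallyEq ?_, fun h' => absurd h' h.not_gt⟩
    filter_upwards [Iio_mem_nhds h] with s hs
    simp [W, projIcc_of_le_left _ (mem_Iio.1 hs).le]
  · have ht : t ∈ Icc τ T := ⟨h.le, htI.2.le⟩
    refine ⟨_, (htd ht).congr_of_eventuallyEq ?_, fun _ => by rw [hWw t ht]⟩
    filter_upwards [Ioo_mem_nhds h htI.2] with s hs using hWw s (Ioo_subset_Icc_self hs)

variable [NormedSpace ℝ C] [MeasurableSpace C] [BorelSpace C] [SecondCountableTopology C]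

/-- The reference trajectory is an approximate solution for the modified control: its defect is at
most `2 * Λ` times the total measure of the needles. The bound on radius `R + 1` covers the unit
tube of the Picard argument. -/
theorem exists_trajectory_needleControl (hg : IsC1Field g G) (hT : 0 ≤ T)
    (hΛ : IsFieldBound g G (R + 1) M T Λ) (hv : ∀ s, ‖v s‖ ≤ M) (hvm : Measurable v)
    (hω : ∀ i, ‖ω i‖ ≤ M) (hxb : IsTrajectory T g xb v) (hxbc : Continuous xb)
    (hbR : ∀ t ∈ Icc 0 T, ‖xb t‖ ≤ R) {P : ι → Set ℝ} (hPm : ∀ i, MeasurableSet (P i))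
    (hP : Pairwise (Function.onFun Disjoint P)) (hPT : ∀ i, P i ⊆ Ioc 0 T) {ρ : ℝ} (hρ : ρ ≤ 1)
    (hPρ : 2 * (2 * Λ * ∑ i, volume.real (P i)) * Real.exp (2 * Λ * T) ≤ ρ) :
    ∃ x : ℝ → E, x 0 = xb 0 ∧ IsTrajectory T g x (needleControl v ω P) ∧
      ∀ t ∈ Icc 0 T, ‖x t - xb t‖ ≤ ρ := by
  have := FiniteDimensional.complete ℝ E
  have hR : ∀ s ∈ Icc 0 T, ∀ a, ‖a - xb s‖ ≤ 1 → ‖a‖ ≤ R + 1 := fun s hs a ha => by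
    have : ‖a‖ ≤ ‖a - xb s‖ + ‖xb s‖ := by simpa using norm_add_le (a - xb s) (xb s)
    linarith [hbR s hs]
  have hbR' : ∀ s ∈ Icc 0 T, ‖xb s‖ ≤ R + 1 := fun s hs => hR s hs _ (by simp)
  have hu := norm_needleControl_le (v := v) (ω := ω) hP hv hω
  have hum := measurable_needleControl hvm ω hPm
  have hi0 := hg.intervalIntegrable hT hΛ hxbc hbR' hvm hv
  have hi : ∀ x : ℝ → E, Continuous x → (∀ s ∈ Icc 0 T, ‖x s - xb s‖ ≤ 1) →
      IntervalIntegrable (fun s => g (x s) (needleControl v ω P s) s) volume 0 T :=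
    fun x hx hx1 => hg.intervalIntegrable hT hΛ hx (fun s hs => hR s hs _ (hx1 s hs)) hum hu
  have hPs : IntervalIntegrable (fun s => ∑ i, |realInd (P i) s|) volume 0 T := by
    simpa only [Finset.sum_fn] using IntervalIntegrable.sum Finset.univ
      fun i _ => (intervalIntegrable_realInd (hPm i) 0 T).abs
  obtain ⟨x, hxc, hx1, hx⟩ := exists_eq_add_integral_of_approx_solution
    (h := fun a s => g a (needleControl v ω P s) s) (xb := xb) (x₀ := xb 0) (T := T) (Λ := Λ)
    (η := 2 * Λ * ∑ i, volume.real (P i)) hT hΛ.pos hxbc hi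
    (fun s hs a b ha hb => hΛ.norm_sub_le hg (hR s hs a ha) (hR s hs b hb) (hu s) hs)
    (fun t ht => by
      have hsub : uIcc 0 t ⊆ uIcc 0 T := uIcc_subset_uIcc left_mem_uIcc (by rwa [uIcc_of_le hT])
      have h1 := hxb.1.eq_add_integral hT hxb.2 hi0 ht
      have h2 : xb 0 + (∫ s in 0..t, g (xb s) (needleControl v ω P s) s) - xb t =
          ∫ s in 0..t, ∑ i, realInd (P i) s • (g (xb s) (ω i) s - g (xb s) (v s) s) := by
        rw [h1, add_sub_add_left_eq_sub, ← intervalIntegral.integral_sub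
          ((hi xb hxbc (by simp)).mono_set hsub) (hi0.mono_set hsub)]
        refine intervalIntegral.integral_congr fun s _ => ?_
        have := map_needleControl (v := v) (ω := ω) hP (fun c => g (xb s) c s) s
        simp only [this]; abel
      have h3 : ∑ i, volume.real (P i) = ∫ s in 0..T, ∑ i, |realInd (P i) s| := by
        rw [intervalIntegral.integral_finsetSum
          fun i _ => (intervalIntegrable_realInd (hPm i) 0 T).abs]
        simp only [abs_of_nonneg (realInd_nonneg _ _), integral_realInd (hPm _) hT (hPT _)]
      rw [h2, h3, mul_comm, ← intervalIntegral.integral_mul_const]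
      refine le_trans (intervalIntegral.norm_integral_le_of_norm_le ht.1 (ae_of_all _ fun s hs => ?_)
        ((hPs.mul_const (2 * Λ)).mono_set hsub)) (intervalIntegral.integral_mono_interval le_rfl
          ht.1 ht.2 (ae_of_all _ fun s => ?_) (hPs.mul_const (2 * Λ)))
      · have hs' : s ∈ Icc 0 T := ⟨hs.1.le, hs.2.trans ht.2⟩
        refine norm_sum_smul_le_of_norm_le fun i _ => (norm_sub_le _ _).trans ?_
        linarith [hΛ.norm_le _ _ _ (hbR' s hs') (hω i) hs', hΛ.norm_le _ _ _ (hbR' s hs') (hv s) hs']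
      · exact mul_nonneg (Finset.sum_nonneg fun i _ => abs_nonneg _) (by linarith [hΛ.pos]))
    (hPρ.trans hρ)
  have hx1' : ∀ t ∈ Icc 0 T, ‖x t - xb t‖ ≤ ρ := fun t ht => (hx1 t ht).trans hPρ
  refine ⟨x, ?_, IsTrajectory.of_eq_add_integral hT (hi x hxc fun s hs => (hx1' s hs).trans hρ) hx,
    hx1'⟩
  simpa using hx 0 (left_mem_Icc.2 hT)

/-- Multiple needle variations at times where the dynamics is approximately continuous. The
needle number `i` is supported in a set of measure `α i`, and the final point of the
trajectory is an approximately affine function of `α`. -/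
theorem exists_needle_family (hg : IsC1Field g G) (hT : 0 < T) (hv : ∀ s, ‖v s‖ ≤ M)
    (hvm : Measurable v) [ProperSpace C] (hω : ∀ i, ‖ω i‖ ≤ M) (hxb : IsTrajectory T g xb v)
    (hxbc : Continuous xb) {τ : ι → ℝ} (hτ : ∀ i, τ i ∈ Ico 0 T) {w : ι → ℝ → E}
    (hw : ∀ i, AbsolutelyContinuousOnInterval (w i) (τ i) T)
    (hwd : ∀ i, ∀ᵐ t ∂(volume.restrict (Icc (τ i) T)),
      HasDerivAt (w i) (G (xb t) (v t) t (w i t)) t)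
    {y : ι → E} (hwτ : ∀ i, w i (τ i) = g (xb (τ i)) (ω i) (τ i) - y i)
    (hpos : ∀ i, ∀ ε > 0, ∀ δ > 0,
      0 < volume {s | s ∈ Ioo (τ i) (min (τ i + δ) T) ∧ ‖g (xb s) (v s) s - y i‖ < ε})
    {ε : ℝ} (hε : 0 < ε) :
    ∃ r > 0, ∃ (A : ι → ℝ → Set ℝ) (x : (ι → ℝ) → ℝ → E),
      (∀ i a, MeasurableSet (A i a)) ∧
      (∀ α : ι → ℝ, Pairwise (Function.onFun Disjoint fun i => A i (α i))) ∧
      (∀ i, volume (A i 0) = 0) ∧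
      (∀ α : ι → ℝ, (∀ i, α i ∈ Icc 0 r) → x α 0 = xb 0 ∧
        IsTrajectory T g (x α) (needleControl v ω fun i => A i (α i))) ∧
      ∀ α β : ι → ℝ, (∀ i, α i ∈ Icc 0 r) → (∀ i, β i ∈ Icc 0 r) →
        (∀ i, ∫ s in 0..T, |realInd (A i (α i)) s - realInd (A i (β i)) s| = |α i - β i|) ∧
        ‖x α T - x β T - ∑ i, (α i - β i) • w i T‖ ≤ ε * ∑ i, |α i - β i| := by
  have := FiniteDimensional.complete ℝ E
  have := FiniteDimensional.proper_real E
  borelize E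
  obtain ⟨R, hbR⟩ := isCompact_Icc.exists_bound_of_continuousOn (hxb.continuousOn hT.le)
  obtain ⟨Λ, hΛ⟩ := hg.exists_bound (R + 1) M T
  have hΛ0 := hΛ.pos
  have hbR' : ∀ t ∈ Icc 0 T, ‖xb t‖ ≤ R + 1 := fun t ht => (hbR t ht).trans (by linarith)
  choose W hWc hWac hWτ hWT hWd using fun i =>
    exists_extension_of_linearized hΛ hv hbR' (hτ i) (hw i) (hwd i)
  -- This is the constant of the first-order estimate when `ε₁` and `ε₂` equal `c` and `c` bounds
  -- both `ρ` and the total measure of the needles.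
  obtain ⟨c, hc0, hc⟩ : ∃ c > 0, (c + 2 * Λ * c + (c * T + 2 * Λ * c) *
      (2 * Λ * Real.exp (Λ * T))) * Real.exp (Λ * T) ≤ ε := by
    refine ⟨ε / ((1 + 2 * Λ + (T + 2 * Λ) * (2 * Λ * Real.exp (Λ * T))) * Real.exp (Λ * T)),
      by positivity, le_of_eq ?_⟩
    have : (1 + 2 * Λ + (T + 2 * Λ) * (2 * Λ * Real.exp (Λ * T))) * Real.exp (Λ * T) ≠ 0 := by
      positivity
    field_simp
  obtain ⟨δ, hδ0, hδ⟩ := hg.exists_linear_approx (R + 1) M T hc0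
  obtain ⟨ρ, hρ0, hρ1, hρδ, hρc⟩ : ∃ ρ > 0, ρ ≤ 1 ∧ ρ ≤ δ ∧ ρ ≤ c :=
    ⟨min 1 (min δ c), by positivity, min_le_left _ _, (min_le_right _ _).trans (min_le_left _ _),
      (min_le_right _ _).trans (min_le_right _ _)⟩
  let S : ι → Set ℝ := fun i =>
    {s | s ∈ Ioo (τ i) T ∧ ‖g (xb s) (ω i) s - g (xb s) (v s) s - W i s‖ < c}
  have hSm : ∀ i, MeasurableSet (S i) := fun i => by
    have h1 : Measurable fun s => g (xb s) (ω i) s :=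
      hg.continuous.measurable.comp ((hxbc.measurable.prodMk measurable_const).prodMk measurable_id)
    have h2 : Measurable fun s => g (xb s) (v s) s :=
      hg.continuous.measurable.comp ((hxbc.measurable.prodMk hvm).prodMk measurable_id)
    exact measurableSet_Ioo.inter
      (measurableSet_lt ((h1.sub h2).sub (hWc i).measurable).norm measurable_const)
  have hST : ∀ i, S i ⊆ Ioc (τ i) T := fun i s hs => Ioo_subset_Ioc_self hs.1
  have hST₀ : ∀ i, S i ⊆ Ioc 0 T := fun i => (hST i).trans (Ioc_subset_Ioc_left (hτ i).1)
  have hSpos : ∀ i, 0 < volume.real (S i) := by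
    intro i
    have hcont : Continuous fun s => g (xb s) (ω i) s - W i s :=
      (hg.continuous.comp ((hxbc.prodMk continuous_const).prodMk continuous_id)).sub (hWc i)
    -- At `τ i` this continuous function equals `y i`, which accounts for one half of `c`; `hpos`
    -- supplies the other half on a non-null set.
    obtain ⟨d, hd0, hd⟩ := Metric.continuousAt_iff.1 (hcont.continuousAt (x := τ i)) (c / 2)
      (by positivity)
    refine ENNReal.toReal_pos ((hpos i (c / 2) (by positivity) d hd0).trans_le
      (measure_mono fun s hs => ?_)).ne' ((measure_mono (hST₀ i)).trans_lt measure_Ioc_lt_top).ne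
    refine ⟨⟨hs.1.1, hs.1.2.trans_le (min_le_right _ _)⟩, ?_⟩
    have h1 := hd (x := s) (by
      rw [Real.dist_eq, abs_of_pos (by linarith [hs.1.1])]
      linarith [hs.1.2.trans_le (min_le_left _ _)])
    rw [hWτ i, hwτ i, sub_sub_cancel, dist_eq_norm] at h1
    calc _ = ‖(g (xb s) (ω i) s - W i s - y i) - (g (xb s) (v s) s - y i)‖ := by congr 1; abel
      _ ≤ _ := norm_sub_le _ _
      _ < c := by linarith [hs.2]
  obtain ⟨B, hBm, hBS, hBpos, hBd⟩ :=
    exists_pairwiseDisjoint_subset_of_volume_pos hT.le hSm hST₀ hSpos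
  choose A hAm hAB hAv hAmono using fun i =>
    exists_monotone_family_of_volume hT.le (hBm i) ((hBS i).trans (hST₀ i))
  obtain ⟨b, hb0, hb⟩ := Pi.exists_forall_pos_add_lt (x := fun _ => (0 : ℝ)) hBpos
  simp only [zero_add] at hb
  set N : ℝ := (Fintype.card ι : ℝ) with hN
  -- The three conditions let the needles have the prescribed measure, keep their total measure
  -- below `c`, and keep trajectories within `ρ` of `xb`. Using `N + 1` in the denominators covers
  -- an empty index type.
  obtain ⟨r, hr0, hrb, hrc, hrρ⟩ : ∃ r > 0, r ≤ b ∧ N * r ≤ c ∧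
      2 * (2 * Λ * (N * r)) * Real.exp (2 * Λ * T) ≤ ρ := by
    have hN0 : 0 ≤ N := by positivity
    refine ⟨min b (min (c / (N + 1)) (ρ / (2 * (2 * Λ * (N + 1)) * Real.exp (2 * Λ * T)))),
      by positivity, min_le_left _ _, ?_, ?_⟩
    · calc _ ≤ (N + 1) * (c / (N + 1)) := mul_le_mul (by linarith)
            ((min_le_right _ _).trans (min_le_left _ _)) (by positivity) (by positivity)
        _ = c := by field_simp
    · calc _ ≤ 2 * (2 * Λ * ((N + 1) * (ρ / (2 * (2 * Λ * (N + 1)) * Real.exp (2 * Λ * T))))) *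
            Real.exp (2 * Λ * T) := by
            gcongr
            · linarith
            · exact (min_le_right _ _).trans (min_le_right _ _)
        _ = ρ := by field_simp
  have hmem : ∀ i, ∀ a ∈ Icc 0 r, a ∈ Icc 0 (volume.real (B i)) := fun i a ha =>
    ⟨ha.1, ha.2.trans (hrb.trans (hb i).le)⟩
  have hAT : ∀ i a, A i a ⊆ Ioc (τ i) T := fun i a => (hAB i a).trans ((hBS i).trans (hST i))
  have hAT₀ : ∀ i a, A i a ⊆ Ioc 0 T := fun i a => (hAB i a).trans ((hBS i).trans (hST₀ i))
  have hAd : ∀ α : ι → ℝ, Pairwise (Function.onFun Disjoint fun i => A i (α i)) :=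
    fun α i j hij => (hBd hij).mono (hAB i _) (hAB j _)
  have hsum : ∀ α : ι → ℝ, (∀ i, α i ∈ Icc 0 r) → ∑ i, volume.real (A i (α i)) ≤ N * r := by
    intro α hα
    rw [hN, ← nsmul_eq_mul, ← Finset.card_univ, ← Finset.sum_const]
    refine Finset.sum_le_sum fun i _ => ?_
    rw [hAv i _ (hmem i _ (hα i))]
    exact (hα i).2
  have hex : ∀ α : ι → ℝ, (∀ i, α i ∈ Icc 0 r) → ∃ x : ℝ → E, x 0 = xb 0 ∧
      IsTrajectory T g x (needleControl v ω fun i => A i (α i)) ∧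
      ∀ t ∈ Icc 0 T, ‖x t - xb t‖ ≤ ρ := fun α hα =>
    exists_trajectory_needleControl hg hT.le hΛ hv hvm hω hxb hxbc hbR (fun i => hAm i _) (hAd α)
      (fun i => hAT₀ i _) hρ1 (le_trans (by gcongr; exact hsum α hα) hrρ)
  choose! x hx0 hx hxρ using hex
  refine ⟨r, hr0, A, x, hAm, hAd, fun i => ?_, fun α hα => ⟨hx0 α hα, hx α hα⟩,
    fun α β hα hβ => ?_⟩
  · have := hAv i 0 ⟨le_rfl, (hBpos i).le⟩
    exact (measureReal_eq_zero_iff ((measure_mono (hAT₀ i 0)).trans_lt measure_Ioc_lt_top).ne).1 this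
  have habs : ∀ i, ∫ s in 0..T, |realInd (A i (α i)) s - realInd (A i (β i)) s| = |α i - β i| := by
    intro i
    rw [integral_abs_realInd_sub (hAm i _) (hAm i _) hT.le (hAT₀ i _) (hAT₀ i _),
      hAv i _ (hmem i _ (hα i)), hAv i _ (hmem i _ (hβ i))]
    rcases le_total (α i) (β i) with h | h
    · exact Or.inl (hAmono i _ (hmem i _ (hα i)) _ (hmem i _ (hβ i)) h)
    · exact Or.inr (hAmono i _ (hmem i _ (hβ i)) _ (hmem i _ (hα i)) h)
  refine ⟨habs, ?_⟩
  have hR : ∀ α : ι → ℝ, (∀ i, α i ∈ Icc 0 r) → ∀ t ∈ Icc 0 T, ‖x α t‖ ≤ R + 1 := by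
    intro α hα t ht
    have : ‖x α t‖ ≤ ‖x α t - xb t‖ + ‖xb t‖ := by simpa using norm_add_le (x α t - xb t) (xb t)
    linarith [hbR t ht, hxρ α hα t ht]
  have key := norm_sub_sub_sum_le_of_needleControl (ρ := ρ) (τ := τ) (W := W) (ε₁ := c) (ε₂ := c)
    hg hT.le hΛ hv hω
    (fun i => hAm i (α i)) (fun i => hAm i (β i)) (hAd α) (hAd β) (hx α hα) (hx β hβ)
    ((hx0 α hα).trans (hx0 β hβ).symm) hbR' (hR α hα) (hR β hβ) (hxρ β hβ) hc0.le
    (fun t ht => hδ _ _ _ (hbR' t ht) (hv t) ht _ _ ((hxρ α hα t ht).trans hρδ)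
      ((hxρ β hβ t ht).trans hρδ)) hWac hWd (fun i => hAT i _) (fun i => hAT i _)
    (fun i => hAT₀ i _) (fun i => hAT₀ i _) hc0.le (fun i t ht => by
      have : t ∈ S i := hBS i (union_subset (hAB i _) (hAB i _) ht)
      exact this.2.le)
  simp only [habs, hWT, hAv _ _ (hmem _ _ (hα _)), hAv _ _ (hmem _ _ (hβ _))] at key
  refine key.trans (mul_le_mul_of_nonneg_right (le_trans ?_ hc)
    (Finset.sum_nonneg fun i _ => abs_nonneg _))
  have hsα : ∑ i, α i ≤ c := by
    refine le_trans ?_ hrc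
    have := hsum α hα
    simpa only [hAv _ _ (hmem _ _ (hα _))] using this
  gcongr

end NeedleFamily

/-! ### Lipschitz selection of nonnegative coefficients. -/

section PositiveSpan

/-- If a set positively spans `ℝⁿ`, then every vector is a nonnegative combination of finitely
many fixed elements of this set, with coefficients which are Lipschitz functions of the vector. -/
theorem exists_lipschitz_nonneg_coefficients {n : ℕ} {S : Set (EuclideanSpace ℝ (Fin n))}
    (hS : (PointedCone.hull ℝ S : Set (EuclideanSpace ℝ (Fin n))) = univ) :
    ∃ (ι : Type) (_ : Fintype ι) (w : ι → EuclideanSpace ℝ (Fin n))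
      (σ : EuclideanSpace ℝ (Fin n) → ι → ℝ) (K : ℝ), 0 ≤ K ∧ (∀ i, w i ∈ S) ∧
      (∀ y i, 0 ≤ σ y i) ∧ σ 0 = 0 ∧ (∀ y y', ∑ i, |σ y i - σ y' i| ≤ K * ‖y - y'‖) ∧
      ∀ y, ∑ i, σ y i • w i = y := by
  let b : Fin n × Bool → EuclideanSpace ℝ (Fin n) := fun q =>
    bif q.2 then EuclideanSpace.single q.1 1 else -EuclideanSpace.single q.1 1
  have hb : ∀ q, ∃ (N : ℕ) (c : Fin N → {c : ℝ // 0 ≤ c}) (w : Fin N → S),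
      ∑ k, c k • (w k : EuclideanSpace ℝ (Fin n)) = b q := fun q => by
    have : b q ∈ (PointedCone.hull ℝ S : Set (EuclideanSpace ℝ (Fin n))) := hS ▸ mem_univ _
    exact Submodule.mem_span_set'.1 this
  choose N c w hw using hb
  -- Positive and negative parts of the coordinates: nonnegative, `1`-Lipschitz and zero at the
  -- origin.
  let s : EuclideanSpace ℝ (Fin n) → Fin n × Bool → ℝ := fun y q =>
    max (bif q.2 then y q.1 else -y q.1) 0
  have hs : ∀ y y' q, |s y q - s y' q| ≤ ‖y - y'‖ := by
    rintro y y' ⟨j, _ | _⟩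
    · refine (abs_max_sub_max_le_abs _ _ _).trans ?_
      have := PiLp.norm_apply_le (y - y') j
      simp only [cond_false]
      rw [neg_sub_neg, abs_sub_comm]
      simpa using this
    · refine (abs_max_sub_max_le_abs _ _ _).trans ?_
      have := PiLp.norm_apply_le (y - y') j
      simpa using this
  refine ⟨Σ q, Fin (N q), inferInstance, fun i => w i.1 i.2, fun y i => s y i.1 * c i.1 i.2,
    ∑ i : (Σ q, Fin (N q)), (c i.1 i.2 : ℝ), Finset.sum_nonneg fun i _ => (c i.1 i.2).2,
    fun i => (w i.1 i.2).2, fun y i => mul_nonneg (le_max_right _ _) (c i.1 i.2).2, ?_, ?_, ?_⟩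
  · ext ⟨⟨j, _ | _⟩, k⟩ <;> simp [s]
  · intro y y'
    rw [Finset.sum_mul]
    refine Finset.sum_le_sum fun i _ => ?_
    rw [← sub_mul, abs_mul, abs_of_nonneg (c i.1 i.2).2, mul_comm]
    exact mul_le_mul_of_nonneg_left (hs y y' i.1) (c i.1 i.2).2
  · intro y
    have h1 : ∀ q, ∑ k, (s y q * c q k) • (w q k : EuclideanSpace ℝ (Fin n)) = s y q • b q := by
      intro q
      rw [← hw q, Finset.smul_sum]
      exact Finset.sum_congr rfl fun k _ => mul_smul _ _ _
    have h2 : ∀ j, s y (j, true) • b (j, true) + s y (j, false) • b (j, false)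
        = EuclideanSpace.single j (y j) := by
      intro j
      have h3 : max (y j) 0 - max (-y j) 0 = y j := by
        rcases le_total 0 (y j) with h | h
        · rw [max_eq_left h, max_eq_right (by linarith)]; ring
        · rw [max_eq_right h, max_eq_left (by linarith)]; ring
      simp only [s, b, cond_true, cond_false, smul_neg, ← sub_eq_add_neg, ← sub_smul, h3]
      ext k
      by_cases hk : k = j <;> simp [hk]
    rw [Fintype.sum_sigma]
    simp only [h1]
    rw [Fintype.sum_prod_type]
    simp only [Fintype.sum_bool, h2]
    ext k
    simp [Finset.sum_apply]

end PositiveSpan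

/-! ### From the control system to the abstract field; local inversion. -/

section Dynamics

variable {n m : ℕ} {T : ℝ} {f : Dynamics n m}

/-- The dynamics `f` with time clamped to `[0,T]`. -/
noncomputable def Dynamics.clamp (f : Dynamics n m) (hT : 0 ≤ T) : Dynamics n m :=
  fun x c t => f x c (projIcc 0 T hT t)

theorem Dynamics.clamp_of_mem (f : Dynamics n m) (hT : 0 ≤ T) (a : EuclideanSpace ℝ (Fin n))
    (c : EuclideanSpace ℝ (Fin m)) {t : ℝ} (ht : t ∈ Icc 0 T) : f.clamp hT a c t = f a c t := by
  simp [Dynamics.clamp, projIcc_of_mem hT ht]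

theorem IsC1Dynamics.exists_isC1Field (hf : IsC1Dynamics T f) (hT : 0 ≤ T) :
    ∃ G, IsC1Field (f.clamp hT) G := by
  have hcl : Continuous fun q : (EuclideanSpace ℝ (Fin n) × EuclideanSpace ℝ (Fin m)) × ℝ =>
      (q.1, (projIcc 0 T hT q.2 : ℝ)) :=
    continuous_fst.prodMk (continuous_subtype_val.comp (continuous_projIcc.comp continuous_snd))
  have hmem : ∀ q : (EuclideanSpace ℝ (Fin n) × EuclideanSpace ℝ (Fin m)) × ℝ,
      (q.1, (projIcc 0 T hT q.2 : ℝ)) ∈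
        (univ : Set (EuclideanSpace ℝ (Fin n) × EuclideanSpace ℝ (Fin m))) ×ˢ Icc 0 T :=
    fun q => ⟨mem_univ _, (projIcc 0 T hT q.2).2⟩
  refine ⟨fun x c t => (fderiv ℝ (fun p : EuclideanSpace ℝ (Fin n) × EuclideanSpace ℝ (Fin m) =>
    f p.1 p.2 (projIcc 0 T hT t)) (x, c)).comp (ContinuousLinearMap.inl ℝ _ _), ?_, ?_, ?_⟩
  · exact hf.continuousOn.comp_continuous hcl hmem
  · exact (hf.continuousOn_fderiv.comp_continuous hcl hmem).clm_comp continuous_const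
  · intro x c t
    have h1 := (hf.differentiable _ (projIcc 0 T hT t).2 (x, c)).hasFDerivAt
    exact HasFDerivAt.comp (f := fun e => (e, c)) x h1 (hasFDerivAt_prodMk_left x c)

theorem trajectory_zero_and_isSolution {x₀ : EuclideanSpace ℝ (Fin n)}
    (u : admissibleControls T f x₀) :
    trajectory u 0 = x₀ ∧ IsSolution f (trajectory u) (u : Control m T) :=
  Classical.choose_spec u.2

/-- A measurable representative is set to `0` where it exceeds the essential bound. The value `0`
may lie outside `U`, which is harmless because membership in `U` is only required almost everywhere.
-/
theorem exists_measurable_bounded_representative (u : Control m T) :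
    ∃ (v : ℝ → EuclideanSpace ℝ (Fin m)) (M : ℝ), 0 ≤ M ∧ Measurable v ∧ (∀ s, ‖v s‖ ≤ M) ∧
      v =ᵐ[timeMeasure T] u := by
  have hu := Lp.memLp u
  obtain ⟨M, hM⟩ : ∃ M : ℝ, ∀ᵐ t ∂(timeMeasure T), ‖u t‖ ≤ M := by
    have h := hu.eLpNorm_lt_top
    rw [eLpNorm_exponent_top] at h
    refine ⟨(eLpNormEssSup u (timeMeasure T)).toReal, ?_⟩
    filter_upwards [ae_le_eLpNormEssSup (f := u) (μ := timeMeasure T)] with t ht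
    rw [← toReal_enorm]
    exact ENNReal.toReal_mono h.ne ht
  let v₁ := hu.aestronglyMeasurable.mk u
  have hv₁ : Measurable v₁ := hu.aestronglyMeasurable.stronglyMeasurable_mk.measurable
  have hS : MeasurableSet {s | ‖v₁ s‖ ≤ max M 0} := measurableSet_le hv₁.norm measurable_const
  refine ⟨{s | ‖v₁ s‖ ≤ max M 0}.indicator v₁, max M 0, le_max_right _ _, hv₁.indicator hS,
    fun s => ?_, ?_⟩
  · by_cases h : s ∈ {s | ‖v₁ s‖ ≤ max M 0}
    · rw [indicator_of_mem h]; exact h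
    · rw [indicator_of_notMem h, norm_zero]; exact le_max_right _ _
  · filter_upwards [hM, hu.aestronglyMeasurable.ae_eq_mk] with t h1 h2
    have h3 : v₁ t = u t := h2.symm
    rw [indicator_of_mem, h3]
    simp only [mem_ofPred_eq, h3]
    exact h1.trans (le_max_left _ _)

theorem Control.norm_toL1_sub_le {u u' : Control m T} {ρ : ℝ → ℝ} (hT : 0 ≤ T)
    (hρ : IntervalIntegrable ρ volume 0 T) (h : ∀ᵐ t ∂(timeMeasure T), ‖u t - u' t‖ ≤ ρ t) :
    ‖u.toL1 - u'.toL1‖ ≤ ∫ s in 0..T, ρ s := by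
  rw [L1.norm_eq_integral_norm, intervalIntegral.integral_of_le hT, ← integral_Icc_eq_integral_Ioc]
  rw [intervalIntegrable_iff_integrableOn_Icc_of_le hT] at hρ
  refine integral_mono_ae (L1.integrable_coeFn _).norm hρ ?_
  filter_upwards [h, Lp.coeFn_sub u.toL1 u'.toL1,
    MemLp.coeFn_toLp ((Lp.memLp u).mono_exponent (p := 1) le_top),
    MemLp.coeFn_toLp ((Lp.memLp u').mono_exponent (p := 1) le_top)] with t h1 h2 h3 h4
  rw [h2, Pi.sub_apply]
  simp only [Control.toL1, h3, h4]
  exact h1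

/-- On the ball `Φ` is approximated by the identity with constant `1/2`, so the Lipschitz inverse
function theorem applies; no differentiability of `Φ` is needed. -/
theorem exists_local_section {E X : Type*} [NormedAddCommGroup E] [NormedSpace ℝ E]
    [CompleteSpace E] [PseudoMetricSpace X] {Φ : E → E} {F : E → X} {r K : ℝ} (hr : 0 < r)
    (hΦ : ∀ y ∈ Metric.ball 0 r, ∀ y' ∈ Metric.ball 0 r,
      ‖Φ y - Φ y' - (y - y')‖ ≤ 1 / 2 * ‖y - y'‖)
    (hF : ∀ y ∈ Metric.ball 0 r, ∀ y' ∈ Metric.ball 0 r, dist (F y) (F y') ≤ K * ‖y - y'‖) :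
    ∃ (𝒱 : Set E) (ψ : 𝒱 → E) (h0 : Φ 0 ∈ 𝒱), IsOpen 𝒱 ∧ (∀ z, ψ z ∈ Metric.ball 0 r) ∧
      (∀ z, Φ (ψ z) = z) ∧ ψ ⟨Φ 0, h0⟩ = 0 ∧ Continuous fun z => F (ψ z) := by
  have hA : ApproximatesLinearOn Φ ((ContinuousLinearEquiv.refl ℝ E : E ≃L[ℝ] E) : E →L[ℝ] E)
      (Metric.ball 0 r) (1 / 2) := fun y hy y' hy' => by simpa using hΦ y hy y' hy'
  have hc : Subsingleton E ∨ (1 / 2 : NNReal) <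
      ‖((ContinuousLinearEquiv.refl ℝ E).symm : E →L[ℝ] E)‖₊⁻¹ := by
    rcases subsingleton_or_nontrivial E with h | h
    · exact Or.inl h
    · right
      have : ‖((ContinuousLinearEquiv.refl ℝ E).symm : E →L[ℝ] E)‖₊ = 1 := by
        ext; exact ContinuousLinearMap.norm_id
      rw [this, inv_one]
      norm_num [← NNReal.coe_lt_coe]
  let Ψ := hA.toOpenPartialHomeomorph Φ _ hc Metric.isOpen_ball
  have hΨ : ∀ z, Ψ z = Φ z := fun z => rfl
  have hs : (0 : E) ∈ Ψ.source := Metric.mem_ball_self hr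
  have h0 : Φ 0 ∈ Ψ.target := Ψ.map_source hs
  have hball : ∀ z : Ψ.target, Ψ.symm z ∈ Metric.ball (0 : E) r := fun z => Ψ.map_target z.2
  refine ⟨Ψ.target, fun z => Ψ.symm z, h0, Ψ.open_target, hball, fun z => Ψ.right_inv z.2,
    Ψ.left_inv hs, ?_⟩
  have hFc : ContinuousOn F (Metric.ball 0 r) := by
    refine LipschitzOnWith.continuousOn (K := K.toNNReal) (LipschitzOnWith.of_dist_le_mul ?_)
    intro y hy y' hy'
    refine (hF y hy y' hy').trans ?_
    rw [dist_eq_norm]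
    exact mul_le_mul_of_nonneg_right (Real.le_coe_toNNReal K) (norm_nonneg _)
  exact hFc.comp_continuous (continuousOn_iff_continuous_domRestrict.1 Ψ.continuousOn_symm) hball

end Dynamics

/-! ### The local section of the end-point mapping. -/

theorem proposition5 {n m : ℕ} (T : ℝ) (hT : 0 < T) (f : Dynamics n m) (hf : IsC1Dynamics T f)
    (x₀ : EuclideanSpace ℝ (Fin n)) (U : Set (EuclideanSpace ℝ (Fin m)))
    (u : admissibleControls T f x₀) (hu : (u : Control m T) ∈ controlsIn T U)
    (hreg : IsWeaklyRegular U u) :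
    (∃ (𝒱 : Set (EuclideanSpace ℝ (Fin n))) (h𝒱 : endpoint u ∈ 𝒱)
        (V : 𝒱 → admissibleControls T f x₀),
      IsOpen 𝒱 ∧
      (∀ z, (V z : Control m T) ∈ controlsIn T U) ∧
      Continuous (fun z => (V z : Control m T).toL1) ∧
      V ⟨endpoint u, h𝒱⟩ = u ∧
      (∀ z : 𝒱, endpoint (V z) = z) ∧
      (∀ z ∈ 𝒱, IsReachable T f x₀ U z)) ∧
    endpoint u ∈ interior (accessibleSet T f x₀ U) := by
  obtain ⟨G, hg⟩ := hf.exists_isC1Field hT.le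
  set g := f.clamp hT.le with hgdef
  have hgf : ∀ a c, ∀ t ∈ Icc 0 T, g a c t = f a c t := fun a c t ht => f.clamp_of_mem hT.le a c ht
  have hGf : ∀ x c, ∀ t ∈ Icc 0 T, fderiv ℝ (fun z => f z c t) x = G x c t := fun x c t ht => by
    have := (hg.hasFDerivAt x c t).fderiv
    simpa only [hgf _ _ t ht] using this
  obtain ⟨v, M₀, hM₀, hvm, hvM₀, hvu⟩ := exists_measurable_bounded_representative (u : Control m T)
  obtain ⟨ι, _, y, σ, K, hK, hyS, hσ0, hσz, hσL, hσy⟩ := exists_lipschitz_nonneg_coefficients hreg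
  choose v' hv' τ hτ ω hωU w hwac hwd hwτ hwT using hyS
  obtain ⟨hx0, hxsol⟩ := trajectory_zero_and_isSolution u
  have htraj : IsTrajectory T g (trajectory u) v :=
    IsTrajectory.congr_control (v := (u : Control m T)) (g := f) hxsol hvu hgf
  set xb : ℝ → EuclideanSpace ℝ (Fin n) := fun t => trajectory u (projIcc 0 T hT.le t) with hxbdef
  have hxbeq : EqOn xb (trajectory u) (Icc 0 T) := fun t ht => by
    simp [hxbdef, projIcc_of_mem hT.le ht]
  have hxb : IsTrajectory T g xb v := htraj.congr hT.le hxbeq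
  have hxbc : Continuous xb :=
    (continuousOn_iff_continuous_domRestrict.1 (htraj.continuousOn hT.le)).comp continuous_projIcc
  set M : ℝ := M₀ + ∑ i, ‖ω i‖ with hMdef
  have hωM : ∀ i, ‖ω i‖ ≤ M := fun i => by
    have := Finset.single_le_sum (f := fun i => ‖ω i‖) (fun i _ => norm_nonneg _)
      (Finset.mem_univ i)
    rw [hMdef]
    linarith
  have hvM : ∀ s, ‖v s‖ ≤ M := fun s =>
    (hvM₀ s).trans (le_add_of_nonneg_right (Finset.sum_nonneg fun i _ => norm_nonneg _))
  have hv'v : ∀ i, v' i =ᵐ[timeMeasure T] v := fun i => (hv' i).trans hvu.symm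
  have hτI : ∀ i, τ i ∈ Ico 0 T := fun i => (hτ i).1
  have hτI' : ∀ i, τ i ∈ Icc 0 T := fun i => Ico_subset_Icc_self (hτI i)
  have hwd' : ∀ i, ∀ᵐ t ∂(volume.restrict (Icc (τ i) T)),
      HasDerivAt (w i) (G (xb t) (v t) t (w i t)) t := fun i => by
    filter_upwards [hwd i, ae_restrict_of_ae_restrict_of_subset
      (Icc_subset_Icc_left (hτI i).1) (hv'v i), ae_restrict_mem measurableSet_Icc] with t h1 h2 h3
    have ht : t ∈ Icc 0 T := ⟨(hτI i).1.trans h3.1, h3.2⟩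
    rwa [hGf _ _ t ht, h2, ← hxbeq ht] at h1
  have hwτ' : ∀ i, w i (τ i) =
      g (xb (τ i)) (ω i) (τ i) - f (trajectory u (τ i)) (v' i (τ i)) (τ i) := fun i => by
    rw [hwτ i, hxbeq (hτI' i), hgf _ _ _ (hτI' i)]
  -- The value at `τ i` stays that of the representative `v' i`, for which `τ i` is a Lebesgue
  -- point; only the almost-everywhere part is transferred to the common `v`.
  have hpos : ∀ i, ∀ ε > 0, ∀ δ > 0, 0 < volume {s | s ∈ Ioo (τ i) (min (τ i + δ) T) ∧
      ‖g (xb s) (v s) s - f (trajectory u (τ i)) (v' i (τ i)) (τ i)‖ < ε} := by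
    intro i ε hε δ hδ
    have hae : ∀ᵐ t ∂(timeMeasure T), f (trajectory u t) (v' i t) t = g (xb t) (v t) t := by
      filter_upwards [hv'v i, ae_restrict_mem measurableSet_Icc] with t h1 h2
      rw [h1, hgf _ _ _ h2, hxbeq h2]
    refine (hτ i).volume_pos ?_ hae hε hδ
    obtain ⟨R, hR⟩ := isCompact_Icc.exists_bound_of_continuousOn (hxb.continuousOn hT.le)
    obtain ⟨Λ, hΛ⟩ := hg.exists_bound R M T
    have := hg.intervalIntegrable hT.le hΛ hxbc hR hvm hvM
    rw [intervalIntegrable_iff_integrableOn_Icc_of_le hT.le] at this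
    exact this.congr (hae.mono fun t ht => ht.symm)
  -- Multiplied by the Lipschitz constant `K` of `σ`, this `ε` gives at most the `1/2` of
  -- `exists_local_section`.
  obtain ⟨r, hr, A, x, hAm, hAd, hA0, hx, hxα⟩ := exists_needle_family hg hT hvM hvm hωM hxb hxbc
    hτI hwac hwd' hwτ' hpos (ε := 1 / (2 * (K + 1))) (by positivity)
  let q : (ι → ℝ) → ℝ → EuclideanSpace ℝ (Fin m) := fun α =>
    needleControl v ω fun i => A i (α i)
  have hqM : ∀ α s, ‖q α s‖ ≤ M := fun α s => norm_needleControl_le (hAd α) hvM hωM s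
  have hq : ∀ α, MemLp (q α) ∞ (timeMeasure T) := fun α => memLp_top_of_bound
    (measurable_needleControl hvm ω fun i => hAm i _).aestronglyMeasurable M
    (ae_of_all _ (hqM α))
  let c : (ι → ℝ) → Control m T := fun α => (hq α).toLp
  have hcq : ∀ α, c α =ᵐ[timeMeasure T] q α := fun α => (hq α).coeFn_toLp
  have hq0 : q 0 =ᵐ[timeMeasure T] v := by
    have : ∀ᵐ s ∂(timeMeasure T), ∀ i, s ∉ A i 0 :=
      ae_all_iff.2 fun i => ae_restrict_of_ae (measure_eq_zero_iff_ae_notMem.1 (hA0 i))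
    filter_upwards [this] with s hs using needleControl_of_forall_notMem hs
  have hc0 : c 0 = u := Lp.ext ((hcq 0).trans (hq0.trans hvu))
  have hcU : ∀ α, c α ∈ controlsIn T U := fun α => by
    have hvU : ∀ᵐ t ∂(timeMeasure T), v t ∈ U := by
      filter_upwards [hvu, hu] with t h1 h2
      rwa [h1]
    filter_upwards [hcq α, hvU] with t h1 h2
    rw [h1]
    rcases needleControl_eq_or (v := v) (ω := ω) (hAd α) t with h | ⟨i, h⟩
    · simpa only [q, h] using h2
    · simpa only [q, h] using hωU i
  -- Since `σ` is `K`-Lipschitz and `σ 0 = 0`, this radius keeps all needle parameters in `[0,r]`.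
  have hbox : ∀ z ∈ Metric.ball (0 : EuclideanSpace ℝ (Fin n)) (r / (K + 1)), ∀ i,
      σ z i ∈ Icc 0 r := fun z hz i => by
    refine ⟨hσ0 z i, ?_⟩
    have h1 := hσL z 0
    rw [hσz, sub_zero] at h1
    have h2 := Finset.single_le_sum (f := fun i => |σ z i - (0 : ι → ℝ) i|)
      (fun i _ => abs_nonneg _) (Finset.mem_univ i)
    simp only [Pi.zero_apply, sub_zero] at h1 h2
    have h3 : ‖z‖ < r / (K + 1) := mem_ball_zero_iff.1 hz
    rw [lt_div_iff₀ (by positivity)] at h3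
    nlinarith [le_abs_self (σ z i), norm_nonneg z]
  have hxsol' : ∀ α : ι → ℝ, (∀ i, α i ∈ Icc 0 r) → x α 0 = x₀ ∧ IsTrajectory T g (x α) (q α) :=
    fun α hα => ⟨by rw [(hx α hα).1, hxbeq (left_mem_Icc.2 hT.le), hx0], (hx α hα).2⟩
  have hadm : ∀ α : ι → ℝ, (∀ i, α i ∈ Icc 0 r) → c α ∈ admissibleControls T f x₀ := fun α hα =>
    ⟨x α, (hxsol' α hα).1, (hxsol' α hα).2.congr_control (hcq α) fun a b t ht => (hgf a b t ht).symm⟩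
  have hend : ∀ (a : admissibleControls T f x₀) (α : ι → ℝ), (∀ i, α i ∈ Icc 0 r) →
      (a : Control m T) = c α → endpoint a = x α T := by
    intro a α hα hac
    obtain ⟨h0, h1⟩ := trajectory_zero_and_isSolution a
    have h2 : IsTrajectory T g (trajectory a) (q α) :=
      IsTrajectory.congr_control (v := (a : Control m T)) (g := f) h1
        (by rw [hac]; exact (hcq α).symm) hgf
    exact h2.eqOn hg hT.le (ae_of_all _ (hqM α)) (hxsol' α hα).2
      (h0.trans (hxsol' α hα).1.symm) (right_mem_Icc.2 hT.le)
  have hΦ : ∀ z ∈ Metric.ball (0 : EuclideanSpace ℝ (Fin n)) (r / (K + 1)),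
      ∀ z' ∈ Metric.ball (0 : EuclideanSpace ℝ (Fin n)) (r / (K + 1)),
      ‖x (σ z) T - x (σ z') T - (z - z')‖ ≤ 1 / 2 * ‖z - z'‖ := by
    intro z hz z' hz'
    have h1 := (hxα _ _ (hbox z hz) (hbox z' hz')).2
    simp only [hwT, sub_smul, Finset.sum_sub_distrib, hσy] at h1
    refine h1.trans ?_
    calc _ ≤ 1 / (2 * (K + 1)) * (K * ‖z - z'‖) :=
          mul_le_mul_of_nonneg_left (hσL z z') (by positivity)
      _ ≤ 1 / (2 * (K + 1)) * ((K + 1) * ‖z - z'‖) := by gcongr; linarith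
      _ = _ := by field_simp
  have hF : ∀ z ∈ Metric.ball (0 : EuclideanSpace ℝ (Fin n)) (r / (K + 1)),
      ∀ z' ∈ Metric.ball (0 : EuclideanSpace ℝ (Fin n)) (r / (K + 1)),
      dist (c (σ z)).toL1 (c (σ z')).toL1 ≤ K * (2 * M) * ‖z - z'‖ := by
    intro z hz z' hz'
    have hi : ∀ i, IntervalIntegrable
        (fun s => |realInd (A i (σ z i)) s - realInd (A i (σ z' i)) s|) volume 0 T := fun i =>
      ((intervalIntegrable_realInd (hAm i _) _ _).sub (intervalIntegrable_realInd (hAm i _) _ _)).abs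
    have hi' : IntervalIntegrable (fun s =>
        ∑ i, |realInd (A i (σ z i)) s - realInd (A i (σ z' i)) s|) volume 0 T := by
      simpa only [Finset.sum_fn] using IntervalIntegrable.sum Finset.univ fun i _ => hi i
    rw [dist_eq_norm]
    refine (Control.norm_toL1_sub_le hT.le (hi'.mul_const (2 * M)) ?_).trans ?_
    · filter_upwards [hcq (σ z), hcq (σ z')] with s h1 h2
      rw [h1, h2]
      have := map_needleControl_sub (v := v) (ω := ω) (hAd (σ z)) (hAd (σ z')) id s
      simp only [id] at this
      simp only [q, this]
      refine norm_sum_smul_le_of_norm_le fun i _ => (norm_sub_le _ _).trans ?_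
      linarith [hωM i, hvM s]
    · rw [intervalIntegral.integral_mul_const, intervalIntegral.integral_finsetSum fun i _ => hi i]
      simp only [(hxα _ _ (hbox z hz) (hbox z' hz')).1]
      calc _ ≤ K * ‖z - z'‖ * (2 * M) := mul_le_mul_of_nonneg_right (hσL z z')
            (by linarith [(norm_nonneg _).trans (hvM 0)])
        _ = _ := by ring
  obtain ⟨𝒱, ψ, h0, h𝒱o, hψ, hΦψ, hψ0, hFψ⟩ := exists_local_section (Φ := fun z => x (σ z) T)
    (F := fun z => (c (σ z)).toL1) (div_pos hr (by positivity)) hΦ hF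
  have hbox' : ∀ z : 𝒱, ∀ i, σ (ψ z) i ∈ Icc 0 r := fun z => hbox _ (hψ z)
  have hendu : endpoint u = x (σ 0) T := by
    refine hend u _ (hbox 0 (Metric.mem_ball_self (div_pos hr (by positivity)))) ?_
    rw [hσz, hc0]
  have h𝒱 : endpoint u ∈ 𝒱 := hendu ▸ h0
  let V : 𝒱 → admissibleControls T f x₀ := fun z => ⟨c (σ (ψ z)), hadm _ (hbox' z)⟩
  have hVend : ∀ z : 𝒱, endpoint (V z) = z := fun z =>
    (hend (V z) _ (hbox' z) rfl).trans (hΦψ z)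
  refine ⟨⟨𝒱, h𝒱, V, h𝒱o, fun z => hcU _, hFψ, ?_, hVend, fun z hz => ?_⟩, ?_⟩
  · have h1 : (⟨endpoint u, h𝒱⟩ : 𝒱) = ⟨x (σ 0) T, h0⟩ := Subtype.ext hendu
    have h2 : ψ ⟨endpoint u, h𝒱⟩ = 0 := by rw [h1]; exact hψ0
    refine Subtype.ext ?_
    simp only [V, h2, hσz, hc0]
  · obtain ⟨h0', h1'⟩ := trajectory_zero_and_isSolution (V ⟨z, hz⟩)
    exact ⟨trajectory (V ⟨z, hz⟩), _, h1', hcU _, h0', hVend ⟨z, hz⟩⟩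
  · exact mem_interior.2 ⟨𝒱, fun z hz => ⟨V ⟨z, hz⟩, hcU _, hVend ⟨z, hz⟩⟩, h𝒱o, h𝒱⟩
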